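/- **Setting.** Let $\lambda>0$ and $p\in[0,1]$. Call $x=(x_1,x_2)\in\mathbb Z^2$ even if $x_1+x_2$ is even and odd otherwise. At the sites of $\mathbb Z^2$ there are independent Poisson arrival processes, of rate $\lambda$ at each even site and of rate $1$ at each odd site; let $t_x$ be the time of the first arrival at $x$. In random sequential adsorption with arrival times $(t_x)$ all sites start empty; at time $t_x$ the site $x$ becomes occupied if none of its four neighbours is occupied, and a site becomes blocked once one of its neighbours is occupied. Almost surely every site is eventually either occupied or blocked. An even site is black if occupied and white if blocked; an odd site is black if blocked and white if occupied. To each diamond site $z'=z+(\tfrac12,\tfrac12)$, $z\in\mathbb Z^2$, attach an enhancement variable $T_{z'}$, uniform on $[0,1]$, all independent of each other and of the arrivals; $z'$ is black if $T_{z'}<p$ and white otherwise. Consider the graph on the sites and the diamond sites in which each site is adjacent to its four nearest neighbours in $\mathbb Z^2$ and each diamond site $z'$ is adjacent to the four sites $z$, $z+(1,0)$, $z+(0,1)$, $z+(1,1)$. For $n\in\mathbb N$ let $B(2n)=[-n,n-1]\times[-n,n-1]$, let $H_n$ be the event that there is a path of black vertices of this graph, all lying in $B(2n)$, from a site with first coordinate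 $-n$ to a site with first coordinate $n-1$, and let $h(n,\lambda,p)=P[H_n]$. An even site $x$ is *1-pivotal* if $H_n$ occurs when $t_x$ is set equal to the first arrival time at $x$ but does not occur when $t_x$ is set equal to the second arrival time at $x$, everything else being unchanged. A diamond $x'$ is *2-pivotal* if $H_n$ occurs when $T_{x'}$ is set equal to $0$ but does not occur when $T_{x'}$ is set equal to $1$. Let $P_1(n,\lambda,x)$ be the probability that $x$ is 1-pivotal, and $P_2(n,\lambda,x)$ the probability that $x'$ is 2-pivotal (both also depend on $p$). **Proposition 4.2.** Let $n\in\mathbb N$ and $\lambda>0$. 1. For every $p\in[0,1]$ the series below converges, $h(n,\cdot,p)$ is differentiable at $\lambda$, and $$\frac{\partial h(n,\lambda,p)}{\partial\lambda}=\frac1\lambda\sum_{x\in\mathbb Z^2:\ x\text{ even}}P_1(n,\lambda,x).$$ 2. For every $p\in(0,1]$ the series below converges, $h(n,\lambda,\cdot)$ is differentiable at $p$ as a function on $[0,1]$ (so one-sidedly at $p=1$), and $$\frac{\partial h(n,\lambda,p)}{\partial p}=\sum_{x\in\mathbb Z^2}P_2(n,\lambda,x).$$ -/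

import Mathlib

open MeasureTheory ProbabilityTheory

namespace RSA

/-- The sites of the square lattice `ℤ²`. -/
abbrev Site : Type := ℤ × ℤ

/-- Two sites are neighbours if they are at (graph) distance one in the square lattice. -/
def Neighbour (x y : Site) : Prop := |x.1 - y.1| + |x.2 - y.2| = 1

/-- A site is even if its graph distance from the origin is even. -/
def EvenSite (x : Site) : Prop := Even (|x.1| + |x.2|)

/-- The two possible final states of a site. -/
inductive State : Type
  | occupied
  | blocked

/-- `HasState t x s`: in random sequential adsorption with arrival times `t`, the site `x` ends up
in state `s`. A site becomes occupied on its arrival if no neighbour is occupied at that time,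
that is, if every neighbour that arrived before had been blocked; a site is blocked if a neighbour
that arrived before it is occupied. The inductive predicate is the process run along the arrival
times; almost surely there is no infinite path of decreasing arrival times, and then every site
has exactly one state. -/
inductive HasState (t : Site → ℝ) : Site → State → Prop
  | occupied (x : Site) (h : ∀ y, Neighbour x y → t y < t x → HasState t y State.blocked) :
      HasState t x State.occupied
  | blocked (x y : Site) (hxy : Neighbour x y) (hlt : t y < t x)
      (h : HasState t y State.occupied) : HasState t x State.blocked

/-- Even sites are black if occupied (and white if blocked); odd sites are black if blocked
(and white if occupied). -/
def BlackSite (t : Site → ℝ) (x : Site) : Prop :=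
  (EvenSite x ∧ HasState t x State.occupied) ∨ (¬ EvenSite x ∧ HasState t x State.blocked)

/-- The faces of the `(4,8²)` lattice: the octagon centred at the site `z`, and the diamond
centred at `z' = z + (1/2, 1/2)`, for `z ∈ ℤ²`. -/
inductive Face : Type
  | octagon (z : Site)
  | diamond (z : Site)

/-- Adjacency of an octagon and a diamond: the diamond `z'` is adjacent to the octagons
`z`, `z + (1,0)`, `z + (0,1)` and `z + (1,1)`. -/
def Touches (x z : Site) : Prop := (x.1 = z.1 ∨ x.1 = z.1 + 1) ∧ (x.2 = z.2 ∨ x.2 = z.2 + 1)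

/-- Adjacency of faces of the `(4,8²)` lattice, i.e. adjacency in the centred quadratic lattice. -/
def FaceAdj : Face → Face → Prop
  | .octagon x, .octagon y => Neighbour x y
  | .octagon x, .diamond z => Touches x z
  | .diamond z, .octagon x => Touches x z
  | .diamond _, .diamond _ => False

/-- The centred quadratic lattice, whose vertices are the faces of the `(4,8²)` lattice. -/
def centredQuadraticLattice : SimpleGraph Face where
  Adj := FaceAdj
  symm := ⟨by
    rintro (x | x) (y | y) h
    · simpa only [FaceAdj, Neighbour, abs_sub_comm] using h
    · exact h
    · exact h
    · exact h⟩
  loopless := ⟨by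
    rintro (x | x) h
    · simp [FaceAdj, Neighbour] at h
    · exact h⟩

/-- The centre of a face lies in the box `B(2n) = [-n, n-1] × [-n, n-1]`. (The centre
`z + (1/2, 1/2)` of a diamond lies in this box iff both `z` and `z + (1,1)` do.) -/
def InBox (n : ℕ) : Face → Prop
  | .octagon z => -(n : ℤ) ≤ z.1 ∧ z.1 ≤ n - 1 ∧ -(n : ℤ) ≤ z.2 ∧ z.2 ≤ n - 1
  | .diamond z => -(n : ℤ) ≤ z.1 ∧ z.1 + 1 ≤ n - 1 ∧ -(n : ℤ) ≤ z.2 ∧ z.2 + 1 ≤ n - 1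

/-- Colouring of the faces: octagons are coloured as the corresponding site, the diamond `z'` is
black iff its enhancement variable `T z` is less than `p`. -/
def Black (p : ℝ) (t : Site → ℝ) (T : Site → unitInterval) : Face → Prop
  | .octagon z => BlackSite t z
  | .diamond z => (T z : ℝ) < p

/-- The event `H_n`, as a property of the arrival times `t` and the enhancement variables `T`:
there is a black path inside `B(2n)` from its left side to its right side. -/
def Crossing (n : ℕ) (p : ℝ) (t : Site → ℝ) (T : Site → unitInterval) : Prop :=
  ∃ (u v : Site) (w : centredQuadraticLattice.Walk (.octagon u) (.octagon v)),
    u.1 = -(n : ℤ) ∧ v.1 = (n : ℤ) - 1 ∧ ∀ f ∈ w.support, InBox n f ∧ Black p t T f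

/-- A sample point: the gaps between consecutive arrivals at each site (`(x, 0)` is indexing the
time of the first arrival at `x`, and `(x, k + 1)` the time between arrival number `k + 1` and
arrival number `k + 2`), and the enhancement variables of the diamonds. -/
abbrev Sample : Type := (Site × ℕ → ℝ) × (Site → unitInterval)

/-- The time of the `(k+1)`-th arrival at the site `x`. -/
noncomputable def arrival (ω : Sample) (k : ℕ) (x : Site) : ℝ :=
  ∑ i ∈ Finset.range (k + 1), ω.1 (x, i)

/-- The time `t_x` of the first arrival at `x`. -/
noncomputable def firstArrival (ω : Sample) (x : Site) : ℝ := arrival ω 0 x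

/-- The time of the second arrival at `x`. -/
noncomputable def secondArrival (ω : Sample) (x : Site) : ℝ := arrival ω 1 x

open Classical in
/-- The arrival rate: `lam` at even sites and `1` at odd sites. -/
noncomputable def rate (lam : ℝ) (x : Site) : ℝ := if EvenSite x then lam else 1

/-- The law of the model: independent Poisson arrival processes of rate `rate lam x` at the sites
`x` (independent exponential gaps between arrivals), and independent enhancement variables, uniform
on `[0,1]`. It is meaningful for `lam > 0`. -/
noncomputable def law (lam : ℝ) : Measure Sample :=
  (Measure.infinitePi fun i : Site × ℕ => expMeasure (rate lam i.1)).prod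
    (Measure.infinitePi fun _ : Site => (volume : Measure unitInterval))

/-- `h(n, lam, p)`, the probability of a horizontal black crossing of `B(2n)`. -/
noncomputable def h (n : ℕ) (lam p : ℝ) : ℝ :=
  (law lam).real {ω | Crossing n p (firstArrival ω) ω.2}

/-- The site `x` is 1-pivotal: the crossing occurs if the arrival time at `x` is made equal to the
first arrival there, but not if it is made equal to the second arrival. -/
def Pivotal₁ (n : ℕ) (p : ℝ) (x : Site) (ω : Sample) : Prop :=
  Crossing n p (Function.update (firstArrival ω) x (firstArrival ω x)) ω.2 ∧
    ¬ Crossing n p (Function.update (firstArrival ω) x (secondArrival ω x)) ω.2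

/-- The diamond `x'` is 2-pivotal: the crossing occurs if the enhancement variable of `x'` is made
equal to `0`, but not if it is made equal to `1`. -/
def Pivotal₂ (n : ℕ) (p : ℝ) (x : Site) (ω : Sample) : Prop :=
  Crossing n p (firstArrival ω) (Function.update ω.2 x 0) ∧
    ¬ Crossing n p (firstArrival ω) (Function.update ω.2 x 1)

/-- The probability `P₁(n, lam, x)` (it also depends on `p`) that `x` is 1-pivotal. -/
noncomputable def P₁ (n : ℕ) (lam p : ℝ) (x : Site) : ℝ := (law lam).real {ω | Pivotal₁ n p x ω}

/-- The probability `P₂(n, lam, x)` (it also depends on `p`) that `x'` is 2-pivotal. -/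
noncomputable def P₂ (n : ℕ) (lam p : ℝ) (x : Site) : ℝ := (law lam).real {ω | Pivotal₂ n p x ω}

end RSA

/-! Derivative in $\lambda$. For an event $E$ determined by the first arrivals at a finite set $S$
of sites and by the enhancement variables, the law at rate $l$ is a tilt of the law at rate $r$,
with density $(l/r)^N e^{(r-l)\Sigma}$, where $N$ counts the even sites of $S$ and $\Sigma$ is the
sum of their first arrival times. Differentiating at $l=r$ gives $\frac Nr P(E)-E[\Sigma;E]$
(`hasDerivAt_law_real`). The sum of two independent exponentials has density $ra$ relative to one of
them, so $r\,E[t_x;E]$ is the probability that $E$ holds once $t_x$ is replaced by the second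
arrival (`setLIntegral_gap`). The derivative is therefore $\frac1r$ times the sum over even $x$ of
the drop in probability caused by delaying $x$. For the crossing, blackness is monotone
(`BlackSite.anti`), so this drop is the probability of being 1-pivotal (`P₁_eq_sub`).

The crossing itself depends on infinitely many sites, so it is approximated by crossings seen when
adsorption is explored to depth $2j+1$. The two differ only if arrival times decrease along a walk
of $j$ double steps between odd sites near the box, which has probability at most $C\,16^j/(j+1)!$
(`measureReal_longChain_le`). Odd sites have rate 1 and are untouched by the delay of an even site,
so the bound is uniform in $\lambda$ and survives that delay. A depth-$(2j+1)$ crossing ignores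
sites outside a square of radius $n+2j+1$; this turns the bound into one summable over $x$ and
vanishing as $j\to\infty$ (`abs_influence_sub_P₁_le_weight`). The derivatives then converge locally
uniformly, and the limit may be differentiated.

Derivative in $p$. Only finitely many diamonds matter. Each is given its own threshold, and the
thresholds are moved from $p$ to $q$ one at a time. A single move changes the crossing probability
by exactly $q-p$ times the probability of being pivotal, because pivotality is independent of the
variable at that diamond (`thresholdCrossing_sub`). Pivotal probabilities are Lipschitz in the other
thresholds, so the total error is $O(|q-p|^2)$ (`abs_thresholdCrossing_sub_le`). -/

namespace RSA

/-! ### Adsorption run up to a finite depth -/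

/-- The state of `x` is decided to be `s` by the arrivals at distance less than `k` from `x`. -/
def StateBy (t : Site → ℝ) : ℕ → Site → State → Prop
  | 0, _, _ => False
  | k + 1, x, .occupied => ∀ y, Neighbour x y → t y < t x → StateBy t k y .blocked
  | k + 1, x, .blocked => ∃ y, Neighbour x y ∧ t y < t x ∧ StateBy t k y .occupied

/-- The site `x` is seen to be black by the arrivals at distance less than `k` from `x`. -/
def BlackSiteBy (k : ℕ) (t : Site → ℝ) (x : Site) : Prop :=
  (EvenSite x ∧ StateBy t k x .occupied) ∨ (¬ EvenSite x ∧ StateBy t k x .blocked)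

/-- The neighbours of a site. -/
def nbrs (x : Site) : Finset Site :=
  {(x.1 + 1, x.2), (x.1 - 1, x.2), (x.1, x.2 + 1), (x.1, x.2 - 1)}

/-- The square of side `2 m + 1` about the origin. -/
noncomputable def square (m : ℕ) : Finset Site := Finset.Icc (-(m : ℤ)) m ×ˢ Finset.Icc (-(m : ℤ)) m

lemma mem_nbrs {x y : Site} : y ∈ nbrs x ↔ Neighbour x y := by
  obtain ⟨a, b⟩ := x
  obtain ⟨c, d⟩ := y
  simp only [nbrs, Neighbour, Finset.mem_insert, Finset.mem_singleton, Prod.mk.injEq]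
  rcases abs_cases (a - c) with h | h <;> rcases abs_cases (b - d) with h' | h' <;> omega

lemma mem_square {m : ℕ} {x : Site} :
    x ∈ square m ↔ (-(m : ℤ) ≤ x.1 ∧ x.1 ≤ m) ∧ (-(m : ℤ) ≤ x.2 ∧ x.2 ≤ m) := by
  simp [square, Finset.mem_product]

lemma Neighbour.mem_square {x y : Site} {m : ℕ} (h : Neighbour x y) (hx : x ∈ square m) :
    y ∈ square (m + 1) := by
  rw [← mem_nbrs] at h
  obtain ⟨a, b⟩ := x
  obtain ⟨c, d⟩ := y
  simp only [nbrs, Finset.mem_insert, Finset.mem_singleton, Prod.mk.injEq] at h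
  rw [RSA.mem_square] at *
  simp only at *
  push_cast
  omega

lemma square_mono {m m' : ℕ} (h : m ≤ m') : square m ⊆ square m' := by
  intro x hx
  rw [mem_square] at *
  omega

lemma Neighbour.evenSite_iff {x y : Site} (h : Neighbour x y) : EvenSite x ↔ ¬ EvenSite y := by
  rw [← mem_nbrs] at h
  obtain ⟨a, b⟩ := x
  obtain ⟨c, d⟩ := y
  simp only [nbrs, Finset.mem_insert, Finset.mem_singleton, Prod.mk.injEq] at h
  simp only [EvenSite, Int.even_add, even_abs]
  obtain ⟨rfl, rfl⟩ | ⟨rfl, rfl⟩ | ⟨rfl, rfl⟩ | ⟨rfl, rfl⟩ := h <;>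
    simp only [Int.even_add, Int.even_sub, Int.not_even_one] <;> tauto

lemma StateBy.succ {t : Site → ℝ} {k : ℕ} {x : Site} {s : State} (h : StateBy t k x s) :
    StateBy t (k + 1) x s := by
  induction k generalizing x s with
  | zero => exact h.elim
  | succ k ih =>
    cases s with
    | occupied => exact fun y hy hlt => ih (h y hy hlt)
    | blocked =>
      obtain ⟨y, hy, hlt, h⟩ := h
      exact ⟨y, hy, hlt, ih h⟩

lemma StateBy.mono {t : Site → ℝ} {k l : ℕ} {x : Site} {s : State} (hkl : k ≤ l)
    (h : StateBy t k x s) : StateBy t l x s := by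
  induction hkl with
  | refl => exact h
  | step _ ih => exact ih.succ

lemma StateBy.hasState {t : Site → ℝ} {k : ℕ} {x : Site} {s : State} (h : StateBy t k x s) :
    HasState t x s := by
  induction k generalizing x s with
  | zero => exact h.elim
  | succ k ih =>
    cases s with
    | occupied => exact .occupied x fun y hy hlt => ih (h y hy hlt)
    | blocked =>
      obtain ⟨y, hy, hlt, h⟩ := h
      exact .blocked x y hy hlt (ih h)

/-- A site has finitely many neighbours, so the depths needed by its earlier neighbours have a
maximum. Hence the full process is the increasing union of its finite-depth versions, with no appeal
to almost sure well-foundedness. -/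
lemma HasState.exists_stateBy {t : Site → ℝ} {x : Site} {s : State} (h : HasState t x s) :
    ∃ k, StateBy t k x s := by
  induction h with
  | occupied x _ ih =>
    choose! K hK using ih
    refine ⟨(nbrs x).sup K + 1, fun y hy hlt => ?_⟩
    exact (hK y hy hlt).mono (Finset.le_sup (mem_nbrs.2 hy))
  | blocked x y hxy hlt _ ih =>
    obtain ⟨k, hk⟩ := ih
    exact ⟨k + 1, y, hxy, hlt, hk⟩

lemma BlackSiteBy.blackSite {t : Site → ℝ} {k : ℕ} {x : Site} (h : BlackSiteBy k t x) :
    BlackSite t x :=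
  h.imp (And.imp_right StateBy.hasState) (And.imp_right StateBy.hasState)

lemma blackSite_iff_exists {t : Site → ℝ} {x : Site} :
    BlackSite t x ↔ ∃ k, BlackSiteBy k t x := by
  refine ⟨?_, fun ⟨k, h⟩ => h.blackSite⟩
  rintro (⟨he, h⟩ | ⟨he, h⟩)
  · exact h.exists_stateBy.imp fun k hk => .inl ⟨he, hk⟩
  · exact h.exists_stateBy.imp fun k hk => .inr ⟨he, hk⟩

/-- The state of a site by depth `k` depends on the arrival times at distance at most `k` only. -/
lemma stateBy_congr {t t' : Site → ℝ} {k m : ℕ} {x : Site} {s : State} (hx : x ∈ square m)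
    (ht : ∀ y ∈ square (m + k), t y = t' y) : StateBy t k x s ↔ StateBy t' k x s := by
  induction k generalizing m x s with
  | zero => exact Iff.rfl
  | succ k ih =>
    have key : ∀ y, Neighbour x y → (t y < t x ↔ t' y < t' x) ∧
        ∀ s, StateBy t k y s ↔ StateBy t' k y s := by
      intro y hy
      have hy' := hy.mem_square hx
      refine ⟨?_, fun s => ih hy' fun z hz => ht z (square_mono (by omega) hz)⟩
      rw [ht y (square_mono (by omega) hy'), ht x (square_mono (by omega) hx)]
    cases s with
    | occupied =>
      refine forall_congr' fun y => forall_congr' fun hy => ?_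
      rw [(key y hy).1, (key y hy).2]
    | blocked =>
      refine exists_congr fun y => and_congr_right fun hy => ?_
      rw [(key y hy).1, (key y hy).2]

lemma blackSiteBy_congr {t t' : Site → ℝ} {k m : ℕ} {x : Site} (hx : x ∈ square m)
    (ht : ∀ y ∈ square (m + k), t y = t' y) : BlackSiteBy k t x ↔ BlackSiteBy k t' x := by
  simp only [BlackSiteBy, stateBy_congr hx ht]

/-- Blackness is monotone: delaying arrivals at even sites and advancing them at odd sites
makes fewer sites black. -/
lemma BlackSite.anti {t t' : Site → ℝ} (he : ∀ x, EvenSite x → t x ≤ t' x)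
    (ho : ∀ x, ¬ EvenSite x → t' x ≤ t x) {x : Site} (h : BlackSite t' x) : BlackSite t x := by
  -- The induction is confined to black states, occupied at even sites and blocked at odd ones.
  -- Neighbours have opposite parity, so a derivation of a black state uses black states only, and
  -- each comparison $t_y<t_x$ moves in the favourable direction.
  have key : ∀ x s, HasState t' x s → (EvenSite x ↔ s = .occupied) → HasState t x s := by
    intro x s h
    induction h with
    | occupied x _ ih =>
      intro hs
      have hx : EvenSite x := hs.2 rfl
      refine .occupied x fun y hy hlt => ?_
      have hy' : ¬ EvenSite y := hy.evenSite_iff.1 hx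
      exact ih y hy ((ho y hy').trans_lt (hlt.trans_le (he x hx))) (by simp [hy'])
    | blocked x y hxy hlt _ ih =>
      intro hs
      have hx : ¬ EvenSite x := fun hx => State.noConfusion (hs.1 hx)
      have hy : EvenSite y := by_contra fun hy => hx (hxy.evenSite_iff.2 hy)
      exact .blocked x y hxy ((he y hy).trans_lt (hlt.trans_le (ho x hx))) (ih (by simp [hy]))
  rcases h with ⟨hx, h⟩ | ⟨hx, h⟩
  · exact .inl ⟨hx, key x _ h (by simp [hx])⟩
  · exact .inr ⟨hx, key x _ h (by simp [hx])⟩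

/-! ### Chains of decreasing arrival times -/

/-- The sites reached from `x` by two steps. -/
def twoSteps (x : Site) : Finset Site := (nbrs x).biUnion nbrs

/-- The walks of `m` double steps from `x`. -/
def chains : (m : ℕ) → Site → Finset (Fin (m + 1) → Site)
  | 0, x => {fun _ => x}
  | m + 1, x => (twoSteps x).biUnion fun y => (chains m y).image (Fin.cons x)

lemma card_nbrs_le (x : Site) : (nbrs x).card ≤ 4 := Finset.card_le_four

lemma card_twoSteps_le (x : Site) : (twoSteps x).card ≤ 16 :=
  (Finset.card_biUnion_le_card_mul _ _ 4 fun y _ => card_nbrs_le y).trans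
    (by have := card_nbrs_le x; omega)

lemma card_chains_le (m : ℕ) (x : Site) : (chains m x).card ≤ 16 ^ m := by
  induction m generalizing x with
  | zero => simp [chains]
  | succ m ih =>
    rw [pow_succ']
    exact (Finset.card_biUnion_le_card_mul _ _ _ fun y _ => Finset.card_image_le.trans (ih y)).trans
      (Nat.mul_le_mul_right _ (card_twoSteps_le x))

lemma not_evenSite_of_mem_twoSteps {x y : Site} (hx : ¬ EvenSite x) (hy : y ∈ twoSteps x) :
    ¬ EvenSite y := by
  obtain ⟨z, hz, hy⟩ := Finset.mem_biUnion.1 hy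
  have h1 := (mem_nbrs.1 hz).evenSite_iff
  have h2 := (mem_nbrs.1 hy).evenSite_iff
  tauto

lemma apply_zero_of_mem_chains {m : ℕ} {x : Site} {c : Fin (m + 1) → Site} (hc : c ∈ chains m x) :
    c 0 = x := by
  cases m with
  | zero => simp only [chains, Finset.mem_singleton] at hc; simp [hc]
  | succ m =>
    simp only [chains, Finset.mem_biUnion, Finset.mem_image] at hc
    obtain ⟨y, _, d, _, rfl⟩ := hc
    simp

lemma not_evenSite_of_mem_chains {m : ℕ} {x : Site} (hx : ¬ EvenSite x)
    {c : Fin (m + 1) → Site} (hc : c ∈ chains m x) (i : Fin (m + 1)) : ¬ EvenSite (c i) := by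
  induction m generalizing x with
  | zero => simp only [chains, Finset.mem_singleton] at hc; simpa [hc] using hx
  | succ m ih =>
    simp only [chains, Finset.mem_biUnion, Finset.mem_image] at hc
    obtain ⟨y, hy, d, hd, rfl⟩ := hc
    cases i using Fin.cases with
    | zero => simpa using hx
    | succ i => simpa using ih (not_evenSite_of_mem_twoSteps hx hy) hd i

/-- If the state of a site is not decided by depth `2 m`, then arrival times decrease
along a walk of `m` double steps. -/
lemma HasState.exists_strictAnti {t : Site → ℝ} {m : ℕ} {x : Site} {s : State}
    (h : HasState t x s) (hk : ¬ StateBy t (2 * m) x s) :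
    ∃ c ∈ chains m x, StrictAnti (t ∘ c) := by
  -- A site undecided at depth $k+1$ has an earlier neighbour undecided at depth $k$. Two such steps
  -- use up two units of depth and return to the same parity.
  have step : ∀ {k : ℕ} {x : Site} {s : State}, HasState t x s → ¬ StateBy t (k + 1) x s →
      ∃ y s', Neighbour x y ∧ t y < t x ∧ HasState t y s' ∧ ¬ StateBy t k y s' := by
    intro k x s h hk
    cases h with
    | occupied _ h =>
      simp only [StateBy, not_forall] at hk
      obtain ⟨y, hy, hlt, hk⟩ := hk
      exact ⟨y, _, hy, hlt, h y hy hlt, hk⟩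
    | blocked _ y hxy hlt h => exact ⟨y, _, hxy, hlt, h, fun h' => hk ⟨y, hxy, hlt, h'⟩⟩
  induction m generalizing x s with
  | zero => exact ⟨fun _ => x, by simp [chains], Subsingleton.strictAnti (α := Fin 1) _⟩
  | succ m ih =>
    obtain ⟨y, s', hy, hyt, hs', hk'⟩ := step h hk
    obtain ⟨z, s'', hz, hzt, hs'', hk''⟩ := step hs' hk'
    obtain ⟨c, hc, hct⟩ := ih hs'' hk''
    refine ⟨Fin.cons x c, ?_, ?_⟩
    · simp only [chains, Finset.mem_biUnion, Finset.mem_image]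
      exact ⟨z, Finset.mem_biUnion.2 ⟨y, mem_nbrs.2 hy, mem_nbrs.2 hz⟩, c, hc, rfl⟩
    · rw [Fin.strictAnti_iff_succ_lt] at hct ⊢
      intro i
      cases i using Fin.cases with
      | zero => simpa [apply_zero_of_mem_chains hc] using hzt.trans hyt
      | succ i => simpa [← Fin.succ_castSucc] using hct i

/-- If the colour of a site of `square n` is not decided by depth `2 m + 1`, then arrival times
decrease along a walk of `m` double steps between odd sites. -/
lemma BlackSite.exists_strictAnti {t : Site → ℝ} {m n : ℕ} {x : Site} (hx : x ∈ square n)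
    (h : BlackSite t x) (hk : ¬ BlackSiteBy (2 * m + 1) t x) :
    ∃ y ∈ square (n + 1), ¬ EvenSite y ∧ ∃ c ∈ chains m y, StrictAnti (t ∘ c) := by
  rcases h with ⟨he, h⟩ | ⟨he, h⟩
  · have hk : ¬ StateBy t (2 * m + 1) x .occupied := fun h' => hk (.inl ⟨he, h'⟩)
    cases h with
    | occupied _ h =>
      simp only [StateBy, not_forall] at hk
      obtain ⟨y, hy, hlt, hk⟩ := hk
      exact ⟨y, hy.mem_square hx, hy.evenSite_iff.1 he, (h y hy hlt).exists_strictAnti hk⟩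
  · have hk : ¬ StateBy t (2 * m + 1) x .blocked := fun h' => hk (.inr ⟨he, h'⟩)
    exact ⟨x, square_mono (by omega) hx, he, h.exists_strictAnti fun h' => hk h'.succ⟩

/-! ### Crossings by a set of faces -/

/-- The set `B` of faces contains a path in `B(2n)` from its left side to its right side. -/
def Crosses (n : ℕ) (B : Face → Prop) : Prop :=
  ∃ (u v : Site) (w : centredQuadraticLattice.Walk (.octagon u) (.octagon v)),
    u.1 = -(n : ℤ) ∧ v.1 = (n : ℤ) - 1 ∧ ∀ f ∈ w.support, InBox n f ∧ B f

/-- The colouring of the faces with black octagons at `b` and threshold `θ z` for the diamond at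
`z`. -/
def colouring (b : Site → Prop) (θ : Site → ℝ) (T : Site → unitInterval) : Face → Prop
  | .octagon z => b z
  | .diamond z => (T z : ℝ) < θ z

lemma black_eq_colouring (p : ℝ) (t : Site → ℝ) (T : Site → unitInterval) :
    Black p t T = colouring (BlackSite t) (fun _ => p) T := by
  funext f
  cases f <;> rfl

lemma crossing_iff {n : ℕ} {p : ℝ} {t : Site → ℝ} {T : Site → unitInterval} :
    Crossing n p t T ↔ Crosses n (colouring (BlackSite t) (fun _ => p) T) := by
  rw [← black_eq_colouring]
  rfl

lemma Crosses.mono {n : ℕ} {B B' : Face → Prop} (hB : ∀ f, InBox n f → B f → B' f)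
    (h : Crosses n B) : Crosses n B' := by
  obtain ⟨u, v, w, hu, hv, hw⟩ := h
  exact ⟨u, v, w, hu, hv, fun f hf => ⟨(hw f hf).1, hB f (hw f hf).1 (hw f hf).2⟩⟩

lemma crosses_congr {n : ℕ} {B B' : Face → Prop} (hB : ∀ f, InBox n f → (B f ↔ B' f)) :
    Crosses n B ↔ Crosses n B' :=
  ⟨.mono fun f hf => (hB f hf).1, .mono fun f hf => (hB f hf).2⟩

noncomputable instance : DecidableEq Face := Classical.decEq _

instance : Countable Face :=
  Function.Injective.countable
    (f := fun f : Face => match f with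
      | .octagon z => (Sum.inl z : Site ⊕ Site)
      | .diamond z => Sum.inr z)
    (by rintro (x | x) (y | y) h <;> simp_all)

/-- A crossing uses a finite set of faces. As there are countably many such sets, this writes the
crossing event as a countable union of finite intersections, whence measurability. -/
lemma crosses_iff_exists_finset {n : ℕ} {B : Face → Prop} :
    Crosses n B ↔ ∃ C : Finset Face, Crosses n (· ∈ C) ∧ ∀ f ∈ C, B f := by
  constructor
  · rintro ⟨u, v, w, hu, hv, hw⟩
    exact ⟨w.support.toFinset, ⟨u, v, w, hu, hv, fun f hf => ⟨(hw f hf).1, by simpa using hf⟩⟩,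
      fun f hf => (hw f (by simpa using hf)).2⟩
  · rintro ⟨C, hC, h⟩
    exact hC.mono fun f _ => h f

lemma mem_square_of_inBox {n : ℕ} {z : Site} (h : InBox n (.octagon z)) : z ∈ square n := by
  simp only [InBox] at h
  rw [mem_square]
  omega

lemma mem_square_of_inBox_diamond {n : ℕ} {z : Site} (h : InBox n (.diamond z)) :
    z ∈ square n := by
  simp only [InBox] at h
  rw [mem_square]
  omega

/-- There is a crossing already at depth `k`. -/
def CrossingBy (k n : ℕ) (p : ℝ) (t : Site → ℝ) (T : Site → unitInterval) : Prop :=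
  Crosses n (colouring (BlackSiteBy k t) (fun _ => p) T)

lemma CrossingBy.crossing {k n : ℕ} {p : ℝ} {t : Site → ℝ} {T : Site → unitInterval}
    (h : CrossingBy k n p t T) : Crossing n p t T :=
  crossing_iff.2 <|
    Crosses.mono (by rintro (z | z) _ hz; exacts [BlackSiteBy.blackSite hz, hz]) h

lemma crossingBy_congr {k n : ℕ} {p : ℝ} {t t' : Site → ℝ} {T : Site → unitInterval}
    (ht : ∀ y ∈ square (n + k), t y = t' y) : CrossingBy k n p t T ↔ CrossingBy k n p t' T := by
  refine crosses_congr ?_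
  rintro (z | z) hz
  · exact blackSiteBy_congr (mem_square_of_inBox hz) ht
  · exact Iff.rfl

lemma Crossing.anti {n : ℕ} {p : ℝ} {t t' : Site → ℝ} {T : Site → unitInterval}
    (he : ∀ x, EvenSite x → t x ≤ t' x) (ho : ∀ x, ¬ EvenSite x → t' x ≤ t x)
    (h : Crossing n p t' T) : Crossing n p t T :=
  crossing_iff.2 <| (crossing_iff.1 h).mono <| by
    rintro (z | z) _ hz
    exacts [BlackSite.anti he ho hz, hz]

/-- Diamonds have the same colour at every depth, so if the crossing is not yet seen, some black
octagon in the box is still undecided. -/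
lemma Crossing.exists_strictAnti {m n : ℕ} {p : ℝ} {t : Site → ℝ} {T : Site → unitInterval}
    (h : Crossing n p t T) (hk : ¬ CrossingBy (2 * m + 1) n p t T) :
    ∃ y ∈ square (n + 1), ¬ EvenSite y ∧ ∃ c ∈ chains m y, StrictAnti (t ∘ c) := by
  by_contra hcon
  refine hk ((crossing_iff.1 h).mono ?_)
  rintro (z | z) hz hb
  · by_contra hz'
    exact hcon (BlackSite.exists_strictAnti (mem_square_of_inBox hz) hb hz')
  · exact hb

/-! ### Product measures -/

section InfinitePi

variable {ι X : Type*} [MeasurableSpace X] (μ : ι → Measure X) [∀ i, IsProbabilityMeasure (μ i)]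

/-- Resampling a coordinate preserves a product measure. -/
lemma measurePreserving_update [DecidableEq ι] (j : ι) :
    MeasurePreserving (fun q : (ι → X) × X => Function.update q.1 j q.2)
      ((Measure.infinitePi μ).prod (μ j)) (Measure.infinitePi μ) := by
  have hm : Measurable fun q : (ι → X) × X => Function.update q.1 j q.2 :=
    measurable_update'.comp (measurable_fst.prodMk measurable_snd)
  refine ⟨hm, Measure.eq_infinitePi μ fun s t ht => ?_⟩
  rw [Measure.map_apply hm (MeasurableSet.pi s.countable_toSet fun i _ => ht i)]
  by_cases hj : j ∈ s
  · have : (fun q : (ι → X) × X => Function.update q.1 j q.2) ⁻¹' (Set.pi s t) =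
        (Set.pi (s.erase j : Finset ι) t) ×ˢ t j := by
      ext q
      simp only [Set.mem_preimage, Set.mem_pi, Finset.mem_coe, Set.mem_prod, Finset.mem_erase]
      constructor
      · intro h
        refine ⟨fun i hi => by simpa [hi.1] using h i hi.2, by simpa using h j hj⟩
      · intro h i hi
        by_cases hij : i = j
        · subst hij; simpa using h.2
        · simpa [hij] using h.1 i ⟨hij, hi⟩
    rw [this, Measure.prod_prod, Measure.infinitePi_pi μ fun i _ => ht i,
      Finset.prod_erase_mul _ _ hj]
  · have : (fun q : (ι → X) × X => Function.update q.1 j q.2) ⁻¹' (Set.pi s t) =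
        (Set.pi s t) ×ˢ Set.univ := by
      ext q
      simp only [Set.mem_preimage, Set.mem_pi, Finset.mem_coe, Set.mem_prod, Set.mem_univ, and_true]
      refine forall₂_congr fun i hi => ?_
      rw [Function.update_of_ne (by rintro rfl; exact hj hi)]
    rw [this, Measure.prod_prod, Measure.infinitePi_pi μ fun i _ => ht i, measure_univ, mul_one]

lemma lintegral_infinitePi_update [DecidableEq ι] (j : ι) {f : (ι → X) → ENNReal}
    (hf : Measurable f) :
    ∫⁻ ω, f ω ∂Measure.infinitePi μ =
      ∫⁻ ω, ∫⁻ a, f (Function.update ω j a) ∂μ j ∂Measure.infinitePi μ := by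
  rw [← (measurePreserving_update μ j).lintegral_comp hf, lintegral_prod]
  exact (hf.comp (measurePreserving_update μ j).measurable).aemeasurable

/-- If an event does not depend on the coordinate `j`, it is independent of it. -/
lemma infinitePi_inter_preimage_eval [DecidableEq ι] (j : ι) {E : Set (ι → X)}
    (hE : MeasurableSet E) (hj : ∀ ω a, Function.update ω j a ∈ E ↔ ω ∈ E) {I : Set X}
    (hI : MeasurableSet I) :
    Measure.infinitePi μ (E ∩ {ω | ω j ∈ I}) = Measure.infinitePi μ E * μ j I := by
  have hm : MeasurableSet (E ∩ {ω | ω j ∈ I}) := hE.inter (measurable_pi_apply j hI)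
  rw [← (measurePreserving_update μ j).measure_preimage hm.nullMeasurableSet, ← Measure.prod_prod]
  congr 1
  ext q
  simp [hj]

/-- The coordinates are in a given strict order with probability at most `1 / k!`. -/
lemma measure_strictAnti_le (ν : Measure X) [IsProbabilityMeasure ν] [LinearOrder X]
    [TopologicalSpace X] [OrderClosedTopology X] [SecondCountableTopology X]
    [OpensMeasurableSpace X] {c : ℕ} (z : Fin c → ι) (hz : Function.Injective z)
    (hν : ∀ k, μ (z k) = ν) :
    Measure.infinitePi μ {ω | StrictAnti fun k => ω (z k)} ≤ (Nat.factorial c : ENNReal)⁻¹ := by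
  classical
  have hmeas : ∀ σ : Equiv.Perm (Fin c), MeasurableSet {r : Fin c → X | StrictAnti (r ∘ σ)} := by
    intro σ
    simp only [StrictAnti, Function.comp, Set.ofPred_forall]
    refine MeasurableSet.iInter fun a => MeasurableSet.iInter fun b => MeasurableSet.iInter fun _ =>
      measurableSet_lt (measurable_pi_apply _) (measurable_pi_apply _)
  have hmap : (Measure.infinitePi μ).map (fun ω k => ω (z k)) = Measure.pi fun _ : Fin c => ν := by
    have hm : Measurable fun (ω : ι → X) k => ω (z k) :=
      measurable_pi_lambda _ fun k => measurable_pi_apply _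
    refine (Measure.pi_eq fun s hs => ?_).symm
    rw [Measure.map_apply hm (MeasurableSet.univ_pi hs)]
    have : (fun (ω : ι → X) k => ω (z k)) ⁻¹' (Set.univ.pi s) =
        Set.pi (Finset.univ.map ⟨z, hz⟩ : Finset ι) (Function.extend z s fun _ => Set.univ) := by
      ext ω
      simp [Set.mem_pi, hz.extend_apply]
    rw [this, Measure.infinitePi_pi, Finset.prod_map]
    · simp [hz.extend_apply, hν]
    · intro i hi
      obtain ⟨k, -, rfl⟩ := Finset.mem_map.1 hi
      simpa [hz.extend_apply] using hs k
  have h1 : Measure.infinitePi μ {ω | StrictAnti fun k => ω (z k)} =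
      Measure.pi (fun _ : Fin c => ν) {r | StrictAnti r} := by
    rw [← hmap, Measure.map_apply (measurable_pi_lambda _ fun k => measurable_pi_apply _)
      (hmeas 1)]
    rfl
  have h2 : ∀ σ : Equiv.Perm (Fin c), Measure.pi (fun _ : Fin c => ν) {r | StrictAnti (r ∘ σ)} =
      Measure.pi (fun _ : Fin c => ν) {r | StrictAnti r} := by
    intro σ
    have := (measurePreserving_piCongrLeft (fun _ : Fin c => ν) σ.symm).measure_preimage
      (hmeas 1).nullMeasurableSet
    refine Eq.trans ?_ this
    congr 1
    ext r
    have : (MeasurableEquiv.piCongrLeft (fun _ : Fin c => X) σ.symm) r = r ∘ σ := by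
      funext k
      have := Equiv.piCongrLeft_apply_apply (fun _ : Fin c => X) σ.symm r (σ k)
      simpa [MeasurableEquiv.coe_piCongrLeft] using this
    simp [this]
  -- Two permutations that both sort $r$ decreasingly list the same values in the same order, and
  -- $r$ is injective, so they coincide. The $k!$ orderings are thus disjoint and, by
  -- exchangeability, equiprobable.
  have hdisj : Pairwise (Function.onFun Disjoint fun σ : Equiv.Perm (Fin c) =>
      {r : Fin c → X | StrictAnti (r ∘ σ)}) := by
    intro σ τ hστ
    refine Set.disjoint_left.2 fun r hσ hτ => hστ ?_
    have hr : Set.range (r ∘ σ) = Set.range (r ∘ τ) := by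
      rw [σ.surjective.range_comp, τ.surjective.range_comp]
    have hrev : ∀ ρ : Equiv.Perm (Fin c), Set.range (r ∘ ρ ∘ Fin.rev) = Set.range (r ∘ ρ) :=
      fun ρ => Fin.rev_surjective.range_comp (r ∘ ρ)
    have h := (StrictMono.range_inj (hσ.comp Fin.rev_strictAnti) (hτ.comp Fin.rev_strictAnti)).1
      (by rw [Function.comp_assoc, Function.comp_assoc, hrev, hrev, hr])
    have hinj : Function.Injective r := by
      intro a b hab
      have := hσ.injective (a₁ := σ.symm a) (a₂ := σ.symm b) (by simpa using hab)
      simpa using this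
    ext k
    have := congrFun h k.rev
    simp only [Function.comp, Fin.rev_rev] at this
    exact congrArg _ (hinj this)
  have h3 : ∑ σ : Equiv.Perm (Fin c),
      Measure.pi (fun _ : Fin c => ν) {r | StrictAnti (r ∘ σ)} ≤ 1 := by
    rw [← tsum_fintype (L := .unconditional _), ← measure_iUnion hdisj hmeas]
    exact prob_le_one
  simp only [h2, Finset.sum_const, Finset.card_univ, Fintype.card_perm, Fintype.card_fin,
    nsmul_eq_mul] at h3
  rw [h1, ENNReal.le_inv_iff_mul_le, mul_comm]
  exact h3

end InfinitePi

/-! ### Exponential distributions -/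

lemma expMeasure_eq_withDensity (r : ℝ) :
    expMeasure r = volume.withDensity (exponentialPDF r) := rfl

lemma measurable_exponentialPDF (r : ℝ) : Measurable (exponentialPDF r) :=
  (measurable_exponentialPDFReal r).ennreal_ofReal

/-- Exponential distributions are mutually absolutely continuous. -/
lemma expMeasure_withDensity {l r : ℝ} (hl : 0 < l) (hr : 0 < r) :
    (expMeasure r).withDensity (fun s => ENNReal.ofReal (l / r * Real.exp ((r - l) * s))) =
      expMeasure l := by
  rw [expMeasure_eq_withDensity, expMeasure_eq_withDensity,
    ← withDensity_mul _ (measurable_exponentialPDF r) (by fun_prop)]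
  congr 1
  funext s
  rw [Pi.mul_apply, exponentialPDF_eq, exponentialPDF_eq]
  split_ifs
  · rw [← ENNReal.ofReal_mul (by positivity)]
    congr 1
    have : Real.exp (-(l * s)) = Real.exp (-(r * s)) * Real.exp ((r - l) * s) := by
      rw [← Real.exp_add]; ring_nf
    rw [this]
    field_simp
  · simp

lemma ae_nonneg_expMeasure (r : ℝ) : ∀ᵐ a ∂expMeasure r, 0 ≤ a := by
  rw [expMeasure_eq_withDensity, ae_withDensity_iff (measurable_exponentialPDF r)]
  refine .of_forall fun x hx => ?_
  by_contra h
  exact hx (exponentialPDF_of_neg (not_le.1 h))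

/-- The sum of two independent exponential variables is size-biased exponential. -/
lemma lintegral_add_expMeasure {r : ℝ} (hr : 0 < r) {g : ℝ → ENNReal} (hg : Measurable g) :
    ∫⁻ a, ∫⁻ b, g (a + b) ∂expMeasure r ∂expMeasure r =
      ∫⁻ a, ENNReal.ofReal (r * a) * g a ∂expMeasure r := by
  have hm := measurable_exponentialPDF r
  simp only [expMeasure_eq_withDensity]
  have h1 : ∀ a, ∫⁻ b, g (a + b) ∂volume.withDensity (exponentialPDF r) =
      ∫⁻ s, exponentialPDF r (s - a) * g s := by
    intro a
    rw [lintegral_withDensity_eq_lintegral_mul _ hm (by fun_prop),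
      ← lintegral_add_right_eq_self (fun s => exponentialPDF r (s - a) * g s) a]
    simp [add_comm]
  simp only [h1]
  rw [lintegral_withDensity_eq_lintegral_mul _ hm
      (Measurable.lintegral_prod_right' (f := fun q : ℝ × ℝ => exponentialPDF r (q.2 - q.1) * g q.2)
        (by fun_prop)),
    lintegral_withDensity_eq_lintegral_mul _ hm (by fun_prop)]
  simp only [Pi.mul_apply]
  simp_rw [← lintegral_const_mul' (exponentialPDF r _) _ (by simp [exponentialPDF])]
  rw [lintegral_lintegral_swap (by fun_prop)]
  refine lintegral_congr fun s => ?_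
  -- The convolution integrand is constant in $a$ on $[0,s]$, so integrating over $a$ gives the
  -- factor $s$.
  have h2 : ∀ a, exponentialPDF r a * (exponentialPDF r (s - a) * g s) =
      (Set.Icc 0 s).indicator
        (fun _ => ENNReal.ofReal (r * r * Real.exp (-(r * s))) * g s) a := by
    intro a
    rw [← mul_assoc]
    by_cases ha : a ∈ Set.Icc 0 s
    · rw [Set.indicator_of_mem ha, exponentialPDF_of_nonneg ha.1,
        exponentialPDF_of_nonneg (sub_nonneg.2 ha.2), ← ENNReal.ofReal_mul (by positivity)]
      congr 2
      rw [mul_mul_mul_comm, ← Real.exp_add]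
      ring_nf
    · rw [Set.indicator_of_notMem ha]
      rcases not_and_or.1 ha with h | h
      · rw [exponentialPDF_of_neg (not_le.1 h)]; simp
      · rw [exponentialPDF_of_neg (sub_neg.2 (not_le.1 h))]; simp
  simp only [h2]
  rw [lintegral_indicator measurableSet_Icc, setLIntegral_const, Real.volume_Icc, sub_zero]
  rcases le_or_gt 0 s with hs | hs
  · rw [exponentialPDF_of_nonneg hs, mul_right_comm, ← mul_assoc,
      ← ENNReal.ofReal_mul (by positivity), ← ENNReal.ofReal_mul (by positivity)]
    congr 2
    ring
  · rw [exponentialPDF_of_neg hs, ENNReal.ofReal_of_nonpos hs.le]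
    simp

/-! ### The law of the model -/

lemma rate_pos {l : ℝ} (hl : 0 < l) (x : Site) : 0 < rate l x := by
  unfold rate
  split_ifs
  exacts [hl, one_pos]

lemma rate_of_evenSite {l : ℝ} {x : Site} (hx : EvenSite x) : rate l x = l := if_pos hx

lemma rate_of_not_evenSite {l : ℝ} {x : Site} (hx : ¬ EvenSite x) : rate l x = 1 := if_neg hx

instance (l : ℝ) [hl : Fact (0 < l)] (x : Site) : IsProbabilityMeasure (expMeasure (rate l x)) :=
  isProbabilityMeasure_expMeasure (rate_pos hl.out x)

/-- The law of the gaps between arrivals. -/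
noncomputable abbrev gapLaw (l : ℝ) : Measure (Site × ℕ → ℝ) :=
  Measure.infinitePi fun i : Site × ℕ => expMeasure (rate l i.1)

/-- The law of the enhancement variables. -/
noncomputable abbrev enhancementLaw : Measure (Site → unitInterval) :=
  Measure.infinitePi fun _ : Site => (volume : Measure unitInterval)

lemma law_eq (l : ℝ) : law l = (gapLaw l).prod enhancementLaw := rfl

instance (l : ℝ) [Fact (0 < l)] : IsProbabilityMeasure (law l) := by
  rw [law_eq]
  infer_instance

lemma firstArrival_apply (ω : Sample) (x : Site) : firstArrival ω x = ω.1 (x, 0) := by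
  simp [firstArrival, arrival]

lemma secondArrival_apply (ω : Sample) (x : Site) :
    secondArrival ω x = ω.1 (x, 0) + ω.1 (x, 1) := by
  simp [secondArrival, arrival, Finset.sum_range_succ]

@[fun_prop]
lemma measurable_firstArrival : Measurable firstArrival := by
  refine measurable_pi_lambda _ fun x => ?_
  simp only [firstArrival_apply]
  fun_prop

@[fun_prop]
lemma measurable_secondArrival : Measurable secondArrival := by
  refine measurable_pi_lambda _ fun x => ?_
  simp only [secondArrival_apply]
  fun_prop

lemma measurableSet_crosses {Ω : Type*} [MeasurableSpace Ω] {n : ℕ} {B : Ω → Face → Prop}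
    (hB : ∀ f, MeasurableSet {ω | B ω f}) : MeasurableSet {ω | Crosses n (B ω)} := by
  have : {ω | Crosses n (B ω)} =
      ⋃ C : {C : Finset Face // Crosses n (· ∈ C)}, ⋂ f ∈ C.1, {ω | B ω f} := by
    ext ω
    simp only [Set.mem_ofPred_eq, Set.mem_iUnion, Set.mem_iInter, Subtype.exists, exists_prop]
    exact crosses_iff_exists_finset
  rw [this]
  exact .iUnion fun C => Finset.measurableSet_biInter _ fun f _ => hB f

lemma measurableSet_stateBy (k : ℕ) (x : Site) (s : State) :
    MeasurableSet {t : Site → ℝ | StateBy t k x s} := by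
  induction k generalizing x s with
  | zero => simp [StateBy]
  | succ k ih =>
    have hlt : ∀ y, MeasurableSet {t : Site → ℝ | t y < t x} := fun y =>
      measurableSet_lt (measurable_pi_apply y) (measurable_pi_apply x)
    cases s with
    | occupied =>
      simp only [StateBy]
      refine measurableSet_setOfPred.2 (Measurable.forall fun y => ?_)
      exact measurable_const.imp ((measurableSet_setOfPred.1 (hlt y)).imp
        (measurableSet_setOfPred.1 (ih y _)))
    | blocked =>
      simp only [StateBy]
      refine measurableSet_setOfPred.2 (Measurable.exists fun y => ?_)
      exact measurable_const.and ((measurableSet_setOfPred.1 (hlt y)).and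
        (measurableSet_setOfPred.1 (ih y _)))

lemma measurableSet_blackSiteBy (k : ℕ) (x : Site) :
    MeasurableSet {t : Site → ℝ | BlackSiteBy k t x} :=
  ((MeasurableSet.const _).inter (measurableSet_stateBy k x _)).union
    ((MeasurableSet.const _).inter (measurableSet_stateBy k x _))

lemma measurableSet_blackSite (x : Site) : MeasurableSet {t : Site → ℝ | BlackSite t x} := by
  simp only [blackSite_iff_exists, Set.ofPred_exists]
  exact .iUnion fun k => measurableSet_blackSiteBy k x

lemma measurableSet_colouring {b : (Site → ℝ) → Site → Prop}
    (hb : ∀ x, MeasurableSet {t | b t x}) (θ : Site → ℝ) (f : Face) :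
    MeasurableSet {q : (Site → ℝ) × (Site → unitInterval) | colouring (b q.1) θ q.2 f} := by
  rcases f with z | z
  · exact measurable_fst (hb z)
  · exact measurableSet_lt (f := fun q : (Site → ℝ) × (Site → unitInterval) => (q.2 z : ℝ))
      (by fun_prop) measurable_const

lemma measurableSet_crossingBy (k n : ℕ) (p : ℝ) :
    MeasurableSet {q : (Site → ℝ) × (Site → unitInterval) | CrossingBy k n p q.1 q.2} :=
  measurableSet_crosses (measurableSet_colouring (measurableSet_blackSiteBy k) _)

lemma measurableSet_crossing (n : ℕ) (p : ℝ) :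
    MeasurableSet {q : (Site → ℝ) × (Site → unitInterval) | Crossing n p q.1 q.2} := by
  simp only [crossing_iff]
  exact measurableSet_crosses (measurableSet_colouring measurableSet_blackSite _)

/-! ### The influence of distant sites -/

/-- Arrival times decrease along a walk of `m` double steps between odd sites near `B(2n)`. -/
def LongChain (n m : ℕ) (t : Site → ℝ) : Prop :=
  ∃ y ∈ square (n + 1), ¬ EvenSite y ∧ ∃ c ∈ chains m y, StrictAnti (t ∘ c)

/-- The chain visits odd sites only, so delaying an arrival at an even site does not affect it. -/
lemma LongChain.congr {n m : ℕ} {t t' : Site → ℝ} (ht : ∀ x, ¬ EvenSite x → t x = t' x)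
    (h : LongChain n m t) : LongChain n m t' := by
  obtain ⟨y, hy, ho, c, hc, ha⟩ := h
  refine ⟨y, hy, ho, c, hc, ?_⟩
  convert ha using 1
  funext i
  exact (ht _ (not_evenSite_of_mem_chains ho hc i)).symm

lemma measureReal_longChain_le (n m : ℕ) (l : ℝ) [Fact (0 < l)] :
    (law l).real {ω | LongChain n m (firstArrival ω)} ≤
      ((square (n + 1)).card * Real.exp 4096) * (1 / 256) ^ m := by
  classical
  have h1 : ∀ y, ¬ EvenSite y → ∀ c ∈ chains m y,
      (law l).real {ω | StrictAnti (firstArrival ω ∘ c)} ≤ ((m + 1).factorial : ℝ)⁻¹ := by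
    intro y hy c hc
    by_cases hinj : Function.Injective c
    · have hz : Function.Injective fun k => (c k, 0) := fun a b hab => hinj (Prod.mk.inj hab).1
      have : {ω : Sample | StrictAnti (firstArrival ω ∘ c)} =
          {r | StrictAnti fun k => r (c k, 0)} ×ˢ Set.univ := by
        ext ω
        simp [Function.comp_def, firstArrival_apply]
      have h := measure_strictAnti_le (fun i : Site × ℕ => expMeasure (rate l i.1))
        (expMeasure (rate l y)) (fun k => (c k, 0)) hz (by
          intro k
          rw [rate_of_not_evenSite hy, rate_of_not_evenSite (not_evenSite_of_mem_chains hy hc k)])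
      rw [measureReal_def, law_eq, this, Measure.prod_prod, measure_univ, mul_one]
      refine (ENNReal.toReal_mono ?_ h).trans ?_
      · simp [Nat.factorial_ne_zero]
      · simp
    -- A walk that revisits a site cannot have strictly decreasing times.
    · have : {ω : Sample | StrictAnti (firstArrival ω ∘ c)} = ∅ := by
        ext ω
        simp only [Set.mem_ofPred_eq, Set.mem_empty_iff_false, iff_false]
        exact fun h => hinj h.injective.of_comp
      rw [this, measureReal_empty]
      positivity
  have h2 : {ω : Sample | LongChain n m (firstArrival ω)} ⊆
      ⋃ y ∈ (square (n + 1)).filter fun y => ¬ EvenSite y, ⋃ c ∈ chains m y,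
        {ω : Sample | StrictAnti (firstArrival ω ∘ c)} := by
    rintro ω ⟨y, hy, ho, c, hc, h⟩
    simp only [Set.mem_iUnion]
    exact ⟨y, Finset.mem_filter.2 ⟨hy, ho⟩, c, hc, h⟩
  have h3 : ∀ y ∈ (square (n + 1)).filter fun y => ¬ EvenSite y,
      (law l).real (⋃ c ∈ chains m y, {ω : Sample | StrictAnti (firstArrival ω ∘ c)}) ≤
        16 ^ m * ((m + 1).factorial : ℝ)⁻¹ := by
    intro y hy
    refine (measureReal_biUnion_finset_le _ _).trans ?_
    refine (Finset.sum_le_card_nsmul _ _ _ (h1 y (Finset.mem_filter.1 hy).2)).trans ?_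
    rw [nsmul_eq_mul]
    gcongr
    exact_mod_cast card_chains_le m y
  -- Here $4096=16\cdot256$; the rate $1/256$ is later split as $\frac1{16}\cdot\frac1{16}$.
  have h4 : (16 : ℝ) ^ m * ((m + 1).factorial : ℝ)⁻¹ ≤ Real.exp 4096 * (1 / 256) ^ m := by
    have h := Real.pow_div_factorial_le_exp (x := 4096) (by norm_num) m
    calc (16 : ℝ) ^ m * ((m + 1).factorial : ℝ)⁻¹ ≤ 16 ^ m * (m.factorial : ℝ)⁻¹ := by
          gcongr
          omega
      _ = (4096 ^ m / m.factorial) * (1 / 256) ^ m := by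
          rw [show (4096 : ℝ) = 16 * 256 by norm_num, mul_pow, one_div, inv_pow]
          field_simp
      _ ≤ _ := by gcongr
  refine (measureReal_mono h2 (measure_ne_top _ _)).trans
    ((measureReal_biUnion_finset_le _ _).trans ?_)
  refine (Finset.sum_le_card_nsmul _ _ _ h3).trans ?_
  rw [nsmul_eq_mul, mul_assoc]
  refine mul_le_mul ?_ h4 (by positivity) (by positivity)
  exact_mod_cast Finset.card_filter_le _ _

/-! ### Changing the rate -/

lemma pi_withDensity {ι : Type*} [Fintype ι] (μ : ι → Measure ℝ) [∀ i, IsProbabilityMeasure (μ i)]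
    {g : ι → ℝ → ENNReal} (hg : ∀ i, Measurable (g i))
    [∀ i, SigmaFinite ((μ i).withDensity (g i))] :
    (Measure.pi μ).withDensity (fun r => ∏ i, g i (r i)) =
      Measure.pi fun i => (μ i).withDensity (g i) := by
  refine (Measure.pi_eq fun s hs => ?_).symm
  have hm : ∀ i, Measurable ((s i).indicator (g i)) := fun i => (hg i).indicator (hs i)
  rw [withDensity_apply _ (MeasurableSet.univ_pi hs),
    ← lintegral_indicator (MeasurableSet.univ_pi hs)]
  have h1 : ∀ r : ι → ℝ, (Set.univ.pi s).indicator (fun r => ∏ i, g i (r i)) r =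
      ∏ i, (s i).indicator (g i) (r i) := by
    intro r
    by_cases hr : r ∈ Set.univ.pi s
    · rw [Set.indicator_of_mem hr]
      exact Finset.prod_congr rfl fun i _ => (Set.indicator_of_mem (hr i trivial) _).symm
    · rw [Set.indicator_of_notMem hr]
      simp only [Set.mem_pi, Set.mem_univ, true_implies, not_forall] at hr
      obtain ⟨i, hi⟩ := hr
      exact (Finset.prod_eq_zero (Finset.mem_univ i) (Set.indicator_of_notMem hi _)).symm
  have h2 := lintegral_prod_eq_prod_lintegral_of_indepFun (μ := Measure.pi μ) Finset.univ
    (fun i (r : ι → ℝ) => (s i).indicator (g i) (r i))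
    (iIndepFun_pi fun i => (hm i).aemeasurable) (fun i => (hm i).comp (measurable_pi_apply i))
  simp only [h1]
  rw [h2]
  refine Finset.prod_congr rfl fun i _ => ?_
  rw [withDensity_apply _ (hs i), ← lintegral_indicator (hs i),
    ← (measurePreserving_eval μ i).lintegral_comp (hm i)]

/-- The total of the first arrival times at the even sites of `S`. -/
noncomputable def evenTotal (S : Finset Site) (ω : Sample) : ℝ :=
  open Classical in ∑ x ∈ S with EvenSite x, ω.1 (x, 0)

/-- The number of even sites of `S`. -/
noncomputable def evenCard (S : Finset Site) : ℕ :=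
  open Classical in (S.filter EvenSite).card

@[fun_prop]
lemma measurable_evenTotal (S : Finset Site) : Measurable (evenTotal S) := by
  unfold evenTotal
  fun_prop

/-- On events depending on the arrivals at finitely many sites only, the law at one rate is a
tilt of the law at another rate. -/
lemma law_apply_eq_setLIntegral (S : Finset Site) {l r : ℝ} (hl : 0 < l) (hr : 0 < r)
    {E : Set Sample} (hE : MeasurableSet E)
    (hS : ∀ ω ω' : Sample, (∀ x ∈ S, ω.1 (x, 0) = ω'.1 (x, 0)) → ω.2 = ω'.2 → (ω ∈ E ↔ ω' ∈ E)) :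
    law l E = ∫⁻ ω in E,
      ENNReal.ofReal ((l / r) ^ evenCard S * Real.exp ((r - l) * evenTotal S ω)) ∂law r := by
  classical
  have : Fact (0 < l) := ⟨hl⟩
  have : Fact (0 < r) := ⟨hr⟩
  -- For different rates the full infinite products have no mutual density, so both laws are first
  -- projected to the finitely many gaps that matter.
  set S' : Finset (Site × ℕ) := S ×ˢ {0} with hS'
  have mem_S' : ∀ x ∈ S, (x, 0) ∈ S' := fun x hx => by simp [hS', hx]
  let Φ : Sample → (S' → ℝ) × (Site → unitInterval) := Prod.map S'.restrict id
  have hΦ : Measurable Φ := (Finset.measurable_restrict S').prodMap measurable_id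
  let ext : (S' → ℝ) × (Site → unitInterval) → Sample :=
    fun q => (fun i => if h : i ∈ S' then q.1 ⟨i, h⟩ else 0, q.2)
  have hext : Measurable ext := by
    refine Measurable.prodMk (measurable_pi_lambda _ fun i => ?_) measurable_snd
    by_cases h : i ∈ S'
    · simp only [h, dite_true]; fun_prop
    · simp only [h, dite_false]; fun_prop
  have hEΦ : E = Φ ⁻¹' (ext ⁻¹' E) := by
    ext ω
    refine hS _ _ (fun x hx => ?_) rfl
    simp [ext, Φ, mem_S' x hx]
  have hmap : ∀ (k : ℝ) [Fact (0 < k)], (law k).map Φ =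
      (Measure.pi fun i : S' => expMeasure (rate k i.1.1)).prod enhancementLaw := by
    intro k _
    rw [law_eq, ← Measure.map_prod_map _ _ (Finset.measurable_restrict S') measurable_id,
      Measure.infinitePi_map_restrict, Measure.map_id]
  let g : S' → ℝ → ENNReal := fun i s => ENNReal.ofReal
    (rate l i.1.1 / rate r i.1.1 * Real.exp ((rate r i.1.1 - rate l i.1.1) * s))
  have hgm : ∀ i, Measurable (g i) := fun i => by fun_prop
  have hg : ∀ i : S', (expMeasure (rate r i.1.1)).withDensity (g i) = expMeasure (rate l i.1.1) :=
    fun i => expMeasure_withDensity (rate_pos hl _) (rate_pos hr _)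
  have hfin : ∀ i : S', SigmaFinite ((expMeasure (rate r i.1.1)).withDensity (g i)) := fun i => by
    rw [hg]; infer_instance
  have hdens := pi_withDensity (fun i : S' => expMeasure (rate r i.1.1)) hgm
  simp only [hg] at hdens
  have hprod : ∀ ω : Sample, ∏ i : S', g i ((Φ ω).1 i) =
      ENNReal.ofReal ((l / r) ^ evenCard S * Real.exp ((r - l) * evenTotal S ω)) := by
    intro ω
    have h1 : ∏ i : S', g i ((Φ ω).1 i) = ∏ i ∈ S', ENNReal.ofReal
        (rate l i.1 / rate r i.1 * Real.exp ((rate r i.1 - rate l i.1) * ω.1 i)) :=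
      Finset.prod_coe_sort S' fun i => ENNReal.ofReal
        (rate l i.1 / rate r i.1 * Real.exp ((rate r i.1 - rate l i.1) * ω.1 i))
    rw [h1, hS', Finset.prod_product]
    simp only [Finset.prod_singleton]
    rw [← ENNReal.ofReal_prod_of_nonneg]
    · congr 1
      rw [evenCard, evenTotal, Finset.mul_sum, Real.exp_sum, ← Finset.prod_const,
        ← Finset.prod_mul_distrib, Finset.prod_filter]
      refine Finset.prod_congr rfl fun x _ => ?_
      split_ifs with hx
      · rw [rate_of_evenSite hx, rate_of_evenSite hx]
      · rw [rate_of_not_evenSite hx, rate_of_not_evenSite hx]; simp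
    · intro x _
      have := rate_pos hl x
      have := rate_pos hr x
      positivity
  have hE' : MeasurableSet (ext ⁻¹' E) := hext hE
  have hgp' : Measurable fun q : S' → ℝ => ∏ i : S', g i (q i) :=
    Finset.measurable_prod _ fun i _ => (hgm i).comp (by fun_prop)
  have hgp : Measurable fun q : (S' → ℝ) × (Site → unitInterval) => ∏ i : S', g i (q.1 i) :=
    Finset.measurable_prod _ fun i _ => (hgm i).comp (by fun_prop)
  rw [hEΦ, ← Measure.map_apply hΦ hE', hmap l, ← hdens,
    prod_withDensity_left hgp',
    withDensity_apply _ hE', ← hmap r, setLIntegral_map hE' hgp hΦ]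
  simp only [hprod]

/-! ### Differentiation in the rate of the even sites -/

/-- The derivative of the probability of an event that depends on the arrivals at finitely many
sites only. -/
lemma hasDerivAt_law_real (S : Finset Site) {r : ℝ} (hr : 0 < r) {E : Set Sample}
    (hE : MeasurableSet E)
    (hS : ∀ ω ω' : Sample, (∀ x ∈ S, ω.1 (x, 0) = ω'.1 (x, 0)) → ω.2 = ω'.2 → (ω ∈ E ↔ ω' ∈ E)) :
    HasDerivAt (fun l => (law l).real E)
      (evenCard S / r * (law r).real E - ∫ ω in E, evenTotal S ω ∂law r) r := by
  have : Fact (0 < r) := ⟨hr⟩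
  -- The tilt integrates to 1, so the exponential moment is finite at $u=r-l$ for every $l>0$. This
  -- covers all $u<r$, a neighbourhood of 0, where the moment generating function may be
  -- differentiated.
  have hint : ∀ l, 0 < l →
      Integrable (fun ω => Real.exp ((r - l) * evenTotal S ω)) (law r) := by
    intro l hl
    have : Fact (0 < l) := ⟨hl⟩
    have hc : 0 < (l / r) ^ evenCard S := by positivity
    have h := law_apply_eq_setLIntegral S hl hr .univ (by simp)
    rw [measure_univ, Measure.restrict_univ] at h
    have h' : Integrable (fun ω => (l / r) ^ evenCard S * Real.exp ((r - l) * evenTotal S ω))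
        (law r) := by
      refine (lintegral_ofReal_ne_top_iff_integrable ?_ ?_).1 (by rw [← h]; simp)
      · exact (by fun_prop : Measurable _).aestronglyMeasurable
      · exact .of_forall fun ω => by positivity
    exact (integrable_const_mul_iff hc.ne'.isUnit _).1 h'
  set ρ := (law r).restrict E with hρ
  have hval : ∀ l, 0 < l →
      (law l).real E = (l / r) ^ evenCard S * mgf (evenTotal S) ρ (r - l) := by
    intro l hl
    rw [measureReal_def, law_apply_eq_setLIntegral S hl hr hE hS, mgf, ← integral_const_mul,
      integral_eq_lintegral_of_nonneg_ae]
    · exact .of_forall fun ω => by positivity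
    · exact (by fun_prop : Measurable _).aestronglyMeasurable
  have h0 : (0 : ℝ) ∈ interior (integrableExpSet (evenTotal S) ρ) := by
    refine mem_interior.2 ⟨Set.Iio r, fun u hu => ?_, isOpen_Iio, hr⟩
    have := (hint (r - u) (sub_pos.2 hu)).restrict (s := E)
    simpa [integrableExpSet] using this
  have h1 : HasDerivAt (fun l => mgf (evenTotal S) ρ (r - l)) (-∫ ω, evenTotal S ω ∂ρ) r := by
    have h := hasDerivAt_mgf h0
    simp only [zero_mul, Real.exp_zero, mul_one] at h
    rw [← sub_self r] at h
    exact (h.comp r ((hasDerivAt_id r).const_sub r)).congr_deriv (by simp)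
  have h2 : HasDerivAt (fun l : ℝ => (l / r) ^ evenCard S) (evenCard S / r) r := by
    exact (((hasDerivAt_id r).div_const r).pow (evenCard S)).congr_deriv
      (by simp [div_self hr.ne', div_eq_mul_inv])
  have h3 := h2.mul h1
  have h4 : mgf (evenTotal S) ρ 0 = (law r).real E := by simp [mgf, hρ, measureReal_def]
  rw [sub_self, h4, div_self hr.ne', one_pow, one_mul, ← sub_eq_add_neg] at h3
  refine h3.congr_of_eventuallyEq ?_
  filter_upwards [lt_mem_nhds hr] with l hl using hval l hl

lemma ae_nonneg_gap (r : ℝ) [Fact (0 < r)] (i : Site × ℕ) : ∀ᵐ ω ∂law r, 0 ≤ ω.1 i := by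
  have h1 : MeasurePreserving (fun ω : Sample => ω.1) (law r) (gapLaw r) := measurePreserving_fst
  have h2 := measurePreserving_eval_infinitePi
    (fun i : Site × ℕ => expMeasure (rate r i.1)) i
  exact (h2.comp h1).quasiMeasurePreserving.ae (ae_nonneg_expMeasure _)

/-- Weighting with the first arrival time amounts to replacing it by the second one. -/
lemma setLIntegral_gap {r : ℝ} (hr : 0 < r) {x : Site} (hx : EvenSite x)
    {E : Set ((Site → ℝ) × (Site → unitInterval))} (hE : MeasurableSet E) :
    ∫⁻ ω in {ω | (firstArrival ω, ω.2) ∈ E}, ENNReal.ofReal (r * ω.1 (x, 0)) ∂law r =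
      law r {ω | (Function.update (firstArrival ω) x (secondArrival ω x), ω.2) ∈ E} := by
  classical
  have : Fact (0 < r) := ⟨hr⟩
  have hm1 : MeasurableSet {ω : Sample | (firstArrival ω, ω.2) ∈ E} :=
    (measurable_firstArrival.prodMk measurable_snd) hE
  have hupd : Measurable fun ω : Sample =>
      Function.update (firstArrival ω) x (secondArrival ω x) :=
    measurable_update'.comp (measurable_firstArrival.prodMk
      ((measurable_pi_apply x).comp measurable_secondArrival))
  have hm2 : MeasurableSet
      {ω : Sample | (Function.update (firstArrival ω) x (secondArrival ω x), ω.2) ∈ E} :=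
    (hupd.prodMk measurable_snd) hE
  rw [← lintegral_indicator_one hm2, ← lintegral_indicator hm1, law_eq,
    lintegral_prod_symm _ (by fun_prop (disch := assumption)),
    lintegral_prod_symm _ (by fun_prop (disch := assumption))]
  refine lintegral_congr fun T => ?_
  let t : (Site × ℕ → ℝ) → Site → ℝ := fun g y => g (y, 0)
  let f : (Site → ℝ) → ENNReal := fun s => E.indicator 1 (s, T)
  have hf : Measurable f := (measurable_one.indicator hE).comp (by fun_prop)
  have ht : Measurable t := measurable_pi_lambda _ fun y => measurable_pi_apply _
  have htu : ∀ g a, t (Function.update g (x, 0) a) = Function.update (t g) x a := by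
    intro g a
    funext y
    by_cases hy : y = x
    · subst hy; simp [t]
    · simp [t, hy]
  have htu' : ∀ g a, t (Function.update g (x, 1) a) = t g := by
    intro g a
    funext y
    simp [t]
  have h1 : ∀ g, {ω : Sample | (firstArrival ω, ω.2) ∈ E}.indicator
      (fun ω => ENNReal.ofReal (r * ω.1 (x, 0))) (g, T) =
        ENNReal.ofReal (r * g (x, 0)) * f (t g) := by
    intro g
    have : firstArrival (g, T) = t g := by funext y; simp [firstArrival_apply, t]
    simp [f, Set.indicator, this]
  have h2 : ∀ g, {ω : Sample |
      (Function.update (firstArrival ω) x (secondArrival ω x), ω.2) ∈ E}.indicator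
      (1 : Sample → ENNReal) (g, T) = f (Function.update (t g) x (g (x, 0) + g (x, 1))) := by
    intro g
    have : firstArrival (g, T) = t g := by funext y; simp [firstArrival_apply, t]
    simp [f, Set.indicator, this, secondArrival_apply]
  simp only [h1, h2]
  have hu : ∀ {α : Type} [MeasurableSpace α] {b : α → ℝ} {s : α → Site → ℝ}, Measurable b →
      Measurable s → Measurable fun g => Function.update (s g) x (b g) :=
    fun hb hs => measurable_update'.comp (hs.prodMk hb)
  have hm3 : Measurable fun g : Site × ℕ → ℝ => ENNReal.ofReal (r * g (x, 0)) * f (t g) := by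
    fun_prop
  have hm4 : Measurable fun g : Site × ℕ → ℝ =>
      f (Function.update (t g) x (g (x, 0) + g (x, 1))) := hf.comp (hu (by fun_prop) ht)
  have hm5 : Measurable fun g : Site × ℕ → ℝ => ∫⁻ b, f (Function.update
      (t (Function.update g (x, 1) b)) x (Function.update g (x, 1) b (x, 0) +
        Function.update g (x, 1) b (x, 1))) ∂expMeasure (rate r x) :=
    Measurable.lintegral_prod_right'
      (hm4.comp (measurable_update'.comp (measurable_fst.prodMk measurable_snd)))
  -- Only the first two gaps at $x$ are resampled. With all other coordinates frozen, the claim is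
  -- the one-dimensional size-biasing identity.
  rw [lintegral_infinitePi_update _ (x, 0) hm3, lintegral_infinitePi_update _ (x, 1) hm4,
    lintegral_infinitePi_update _ (x, 0) hm5]
  refine lintegral_congr fun g => ?_
  simp only [htu, htu', rate_of_evenSite hx, Function.update_self, Function.update_idem, ne_eq,
    Prod.mk.injEq, true_and, zero_ne_one, not_false_eq_true, Function.update_of_ne]
  exact (lintegral_add_expMeasure hr (g := fun a => f (Function.update (t g) x a))
    (hf.comp (hu measurable_id measurable_const))).symm

lemma integrable_gap {r : ℝ} (hr : 0 < r) {x : Site} (hx : EvenSite x) :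
    Integrable (fun ω : Sample => ω.1 (x, 0)) (law r) := by
  have : Fact (0 < r) := ⟨hr⟩
  have h := setLIntegral_gap hr hx .univ
  simp only [Set.mem_univ, Set.ofPred_true, Measure.restrict_univ, measure_univ] at h
  have h' : Integrable (fun ω : Sample => r * ω.1 (x, 0)) (law r) := by
    refine (lintegral_ofReal_ne_top_iff_integrable ?_ ?_).1 (by rw [h]; simp)
    · exact (by fun_prop : Measurable _).aestronglyMeasurable
    · filter_upwards [ae_nonneg_gap r (x, 0)] with ω hω using mul_nonneg hr.le hω
  exact (integrable_const_mul_iff hr.ne'.isUnit _).1 h'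

lemma setIntegral_gap {r : ℝ} (hr : 0 < r) {x : Site} (hx : EvenSite x)
    {E : Set ((Site → ℝ) × (Site → unitInterval))} (hE : MeasurableSet E) :
    r * ∫ ω in {ω | (firstArrival ω, ω.2) ∈ E}, ω.1 (x, 0) ∂law r =
      (law r).real {ω | (Function.update (firstArrival ω) x (secondArrival ω x), ω.2) ∈ E} := by
  have : Fact (0 < r) := ⟨hr⟩
  rw [measureReal_def, ← setLIntegral_gap hr hx hE, ← integral_const_mul,
    integral_eq_lintegral_of_nonneg_ae]
  · refine ae_restrict_of_ae ?_
    filter_upwards [ae_nonneg_gap r (x, 0)] with ω hω using mul_nonneg hr.le hω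
  · exact (by fun_prop : Measurable _).aestronglyMeasurable

/-! ### Crossings of finite depth -/

/-- The effect of delaying the arrival at `x` on the probability of a crossing at depth
`2 j + 1`. -/
noncomputable def influence (n : ℕ) (p : ℝ) (j : ℕ) (l : ℝ) (x : Site) : ℝ :=
  (law l).real {ω | CrossingBy (2 * j + 1) n p (firstArrival ω) ω.2} -
    (law l).real {ω | CrossingBy (2 * j + 1) n p
      (Function.update (firstArrival ω) x (secondArrival ω x)) ω.2}

open Classical in
lemma hasDerivAt_crossingBy (n : ℕ) (p : ℝ) (j : ℕ) {r : ℝ} (hr : 0 < r) :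
    HasDerivAt (fun l => (law l).real {ω | CrossingBy (2 * j + 1) n p (firstArrival ω) ω.2})
      (1 / r * ∑ x ∈ square (n + (2 * j + 1)) with EvenSite x, influence n p j r x) r := by
  have hm := measurableSet_crossingBy (2 * j + 1) n p
  have h := hasDerivAt_law_real (square (n + (2 * j + 1))) hr
    (E := {ω | CrossingBy (2 * j + 1) n p (firstArrival ω) ω.2})
    ((measurable_firstArrival.prodMk measurable_snd) hm) (by
      intro ω ω' h1 h2
      simp only [Set.mem_ofPred_eq, h2]
      exact crossingBy_congr fun y hy => by simpa only [firstArrival_apply] using h1 y hy)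
  refine h.congr_deriv ?_
  have hsum : ∫ ω in {ω | CrossingBy (2 * j + 1) n p (firstArrival ω) ω.2},
      evenTotal (square (n + (2 * j + 1))) ω ∂law r =
      ∑ x ∈ square (n + (2 * j + 1)) with EvenSite x,
        ∫ ω in {ω | CrossingBy (2 * j + 1) n p (firstArrival ω) ω.2}, ω.1 (x, 0) ∂law r := by
    unfold evenTotal
    exact integral_finsetSum _ fun x hx =>
      (integrable_gap hr (Finset.mem_filter.1 hx).2).restrict
  rw [hsum, evenCard, Finset.mul_sum, div_mul_eq_mul_div, ← nsmul_eq_mul, ← Finset.sum_const,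
    Finset.sum_div, ← Finset.sum_sub_distrib]
  refine Finset.sum_congr rfl fun x hx => ?_
  have hx' := setIntegral_gap hr (Finset.mem_filter.1 hx).2 hm
  simp only [Set.mem_ofPred_eq] at hx'
  rw [influence, ← hx']
  field_simp

lemma influence_eq_zero {n : ℕ} {p : ℝ} {j : ℕ} {l : ℝ} {x : Site}
    (hx : x ∉ square (n + (2 * j + 1))) : influence n p j l x = 0 := by
  rw [influence, sub_eq_zero]
  congr 1
  ext ω
  refine crossingBy_congr fun y hy => ?_
  rw [Function.update_of_ne (by rintro rfl; exact hx hy)]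

lemma measurable_delayed (x : Site) : Measurable fun ω : Sample =>
    ((Function.update (firstArrival ω) x (secondArrival ω x), ω.2) :
      (Site → ℝ) × (Site → unitInterval)) := by
  classical
  exact (measurable_update'.comp (measurable_firstArrival.prodMk
    ((measurable_pi_apply x).comp measurable_secondArrival))).prodMk measurable_snd

/-- Gaps are almost surely nonnegative, so by monotonicity the delayed crossing is contained, up to
a null set, in the undelayed one. -/
lemma P₁_eq_sub (n : ℕ) (p l : ℝ) [Fact (0 < l)] {x : Site} (hx : EvenSite x) :
    P₁ n l p x = (law l).real {ω | Crossing n p (firstArrival ω) ω.2} -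
      (law l).real {ω | Crossing n p
        (Function.update (firstArrival ω) x (secondArrival ω x)) ω.2} := by
  have hm := measurableSet_crossing n p
  have hle : {ω : Sample | Crossing n p
      (Function.update (firstArrival ω) x (secondArrival ω x)) ω.2} ≤ᵐ[law l]
      {ω | Crossing n p (firstArrival ω) ω.2} := by
    filter_upwards [ae_nonneg_gap l (x, 1)] with ω hω h
    refine Crossing.anti (fun y _ => ?_) (fun y hy => ?_) h
    · by_cases hy : y = x
      · subst hy
        simpa [firstArrival_apply, secondArrival_apply] using hω
      · rw [Function.update_of_ne hy]
    · rw [Function.update_of_ne (by rintro rfl; exact hy hx)]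
  have hdiff : {ω | Pivotal₁ n p x ω} = {ω | Crossing n p (firstArrival ω) ω.2} \
      {ω | Crossing n p (Function.update (firstArrival ω) x (secondArrival ω x)) ω.2} := by
    ext ω
    simp [Pivotal₁]
  have hm2 := (measurable_delayed x) hm
  have h := measureReal_inter_add_sdiff (μ := law l)
    (s := {ω | Crossing n p (firstArrival ω) ω.2}) hm2
  rw [P₁, hdiff, ← h, eq_sub_iff_add_eq, add_comm]
  congr 1
  refine (measureReal_congr ?_).symm
  have h' : ({ω : Sample | Crossing n p (firstArrival ω) ω.2} ∩
      {ω | Crossing n p (Function.update (firstArrival ω) x (secondArrival ω x)) ω.2} : Set Sample)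
      =ᵐ[law l] {ω | Crossing n p (Function.update (firstArrival ω) x (secondArrival ω x)) ω.2} := by
    filter_upwards [hle] with ω hω
    exact propext ⟨fun h => h.2, fun h => ⟨hω h, h⟩⟩
  exact h'

/-- The constant in the bound on the influence of distant sites. -/
noncomputable def tailConst (n : ℕ) : ℝ := (square (n + 1)).card * Real.exp 4096

lemma tailConst_nonneg (n : ℕ) : 0 ≤ tailConst n := by unfold tailConst; positivity

lemma abs_crossing_sub_crossingBy_le (n : ℕ) (p : ℝ) (j : ℕ) (l : ℝ) [Fact (0 < l)]
    {τ : Sample → Site → ℝ} (hτ : Measurable τ)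
    (hodd : ∀ ω x, ¬ EvenSite x → τ ω x = firstArrival ω x) :
    |(law l).real {ω | CrossingBy (2 * j + 1) n p (τ ω) ω.2} -
      (law l).real {ω | Crossing n p (τ ω) ω.2}| ≤ tailConst n * (1 / 256) ^ j := by
  have hsub : {ω : Sample | CrossingBy (2 * j + 1) n p (τ ω) ω.2} ⊆
      {ω | Crossing n p (τ ω) ω.2} := fun ω h => CrossingBy.crossing h
  rw [abs_sub_comm, ← measureReal_sdiff hsub
    ((hτ.prodMk measurable_snd) (measurableSet_crossingBy (2 * j + 1) n p)),
    abs_of_nonneg measureReal_nonneg]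
  refine le_trans (measureReal_mono ?_) (measureReal_longChain_le n j l)
  rintro ω ⟨h1, h2⟩
  exact LongChain.congr (hodd ω) (Crossing.exists_strictAnti h1 h2)

lemma abs_influence_sub_P₁_le (n : ℕ) (p : ℝ) (j : ℕ) (l : ℝ) [Fact (0 < l)] {x : Site}
    (hx : EvenSite x) :
    |influence n p j l x - P₁ n l p x| ≤ 2 * (tailConst n * (1 / 256) ^ j) := by
  have h1 := abs_crossing_sub_crossingBy_le n p j l measurable_firstArrival fun _ _ _ => rfl
  have h2 := abs_crossing_sub_crossingBy_le n p j l (measurable_fst.comp (measurable_delayed x))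
    (fun ω y hy => Function.update_of_ne (by rintro rfl; exact hy hx) _ _)
  simp only [Function.comp] at h2
  rw [influence, P₁_eq_sub n p l hx, sub_sub_sub_comm, two_mul (_ * _)]
  exact (abs_sub _ _).trans (add_le_add h1 h2)

/-- A summable weight on the sites. -/
noncomputable def weight (x : Site) : ℝ := (1 / 2) ^ x.1.natAbs * (1 / 2) ^ x.2.natAbs

lemma weight_nonneg (x : Site) : 0 ≤ weight x := by unfold weight; positivity

lemma summable_weight : Summable weight := by
  have h : Summable fun a : ℤ => (1 / 2 : ℝ) ^ a.natAbs :=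
    Summable.of_nat_of_neg (by simpa using summable_geometric_two)
      (by simpa using summable_geometric_two)
  exact h.mul_of_nonneg h (fun _ => by positivity) fun _ => by positivity

lemma pow_le_weight {n j : ℕ} {x : Site} (hx : x ∈ square (n + (2 * j + 1))) :
    (1 / 16 : ℝ) ^ j ≤ 4 ^ (n + 1) * weight x := by
  rw [mem_square] at hx
  have h1 : x.1.natAbs ≤ n + (2 * j + 1) := by omega
  have h2 : x.2.natAbs ≤ n + (2 * j + 1) := by omega
  have h3 : ((1 / 2 : ℝ) ^ (n + (2 * j + 1))) * (1 / 2) ^ (n + (2 * j + 1)) ≤ weight x := by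
    unfold weight
    gcongr ?_ * ?_
    · exact pow_le_pow_of_le_one (by norm_num) (by norm_num) h1
    · exact pow_le_pow_of_le_one (by norm_num) (by norm_num) h2
  calc (1 / 16 : ℝ) ^ j
      = 4 ^ (n + 1) * (((1 / 2 : ℝ) ^ (n + (2 * j + 1))) * (1 / 2) ^ (n + (2 * j + 1))) := by
        rw [← mul_pow, show n + (2 * j + 1) = (n + 1) + 2 * j by ring, pow_add _ (n + 1) (2 * j),
          ← mul_assoc, ← mul_pow, pow_mul]
        norm_num
    _ ≤ _ := by gcongr

/-- One factor $16^{-i}$ of $256^{-i}$ pays for summability in $x$, the other for decay in $j$. -/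
lemma abs_influence_sub_P₁_le_weight (n : ℕ) (p : ℝ) (j : ℕ) (l : ℝ) [Fact (0 < l)] {x : Site}
    (hx : EvenSite x) :
    |influence n p j l x - P₁ n l p x| ≤
      (32 * tailConst n * 4 ^ (n + 1)) * (1 / 16) ^ j * weight x := by
  have hC := tailConst_nonneg n
  have hw := weight_nonneg x
  have h256 : ∀ i : ℕ, (1 / 256 : ℝ) ^ i = (1 / 16) ^ i * (1 / 16) ^ i := fun i => by
    rw [← mul_pow]; norm_num
  by_cases hj : x ∈ square (n + (2 * j + 1))
  · refine (abs_influence_sub_P₁_le n p j l hx).trans ?_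
    rw [h256]
    calc 2 * (tailConst n * ((1 / 16) ^ j * (1 / 16) ^ j))
        ≤ 2 * (tailConst n * ((1 / 16) ^ j * (4 ^ (n + 1) * weight x))) := by
          gcongr; exact pow_le_weight hj
      _ = (2 * tailConst n * 4 ^ (n + 1)) * (1 / 16) ^ j * weight x := by ring
      _ ≤ _ := by gcongr; norm_num
  · have hex : ∃ i, x ∈ square (n + (2 * i + 1)) :=
      ⟨x.1.natAbs + x.2.natAbs, by rw [mem_square]; omega⟩
    classical
    -- Here $i\ge j$ is the last index whose square misses $x$. The influence vanishes at $i$ as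
    -- well as at $j$, so the better bound at $i$ applies; passing from $i$ to $i+1$ costs the
    -- factor 16 in $32=2\cdot16$.
    obtain ⟨i, hi⟩ : ∃ i, Nat.find hex = i + 1 := by
      refine Nat.exists_eq_succ_of_ne_zero fun h0 => hj ?_
      exact square_mono (by omega) (h0 ▸ Nat.find_spec hex)
    have hi1 : x ∈ square (n + (2 * (i + 1) + 1)) := hi ▸ Nat.find_spec hex
    have hi2 : x ∉ square (n + (2 * i + 1)) := Nat.find_min hex (by omega)
    have hji : j ≤ i := by
      by_contra h
      exact hj (square_mono (by omega) hi1)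
    rw [influence_eq_zero hj, ← influence_eq_zero (p := p) (l := l) hi2]
    refine (abs_influence_sub_P₁_le n p i l hx).trans ?_
    rw [h256]
    have h1 : (1 / 16 : ℝ) ^ i ≤ 16 * (4 ^ (n + 1) * weight x) := by
      have := pow_le_weight hi1
      rw [pow_succ] at this
      linarith
    have h2 : (1 / 16 : ℝ) ^ i ≤ (1 / 16) ^ j :=
      pow_le_pow_of_le_one (by norm_num) (by norm_num) hji
    calc 2 * (tailConst n * ((1 / 16) ^ i * (1 / 16) ^ i))
        ≤ 2 * (tailConst n * ((1 / 16) ^ j * (16 * (4 ^ (n + 1) * weight x)))) := by gcongr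
      _ = _ := by ring

lemma tendsto_crossingBy (n : ℕ) (p l : ℝ) [Fact (0 < l)] :
    Filter.Tendsto (fun j => (law l).real {ω | CrossingBy (2 * j + 1) n p (firstArrival ω) ω.2})
      Filter.atTop (nhds (h n l p)) := by
  rw [tendsto_iff_dist_tendsto_zero]
  have h0 : Filter.Tendsto (fun j : ℕ => tailConst n * (1 / 256 : ℝ) ^ j) Filter.atTop (nhds 0) := by
    simpa using (tendsto_pow_atTop_nhds_zero_of_lt_one (r := (1 / 256 : ℝ)) (by norm_num)
      (by norm_num)).const_mul (tailConst n)
  refine squeeze_zero (fun _ => dist_nonneg) (fun j => ?_) h0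
  exact abs_crossing_sub_crossingBy_le n p j l measurable_firstArrival fun _ _ _ => rfl

open Classical in
lemma summable_influence (n : ℕ) (p : ℝ) (j : ℕ) (l : ℝ) :
    Summable ({x | EvenSite x}.indicator (influence n p j l)) := by
  refine summable_of_ne_finset_zero (s := square (n + (2 * j + 1))) fun x hx => ?_
  simp [Set.indicator, influence_eq_zero hx]

lemma abs_indicator_influence_sub_le (n : ℕ) (p : ℝ) (j : ℕ) (l : ℝ) [Fact (0 < l)] (x : Site) :
    |{x | EvenSite x}.indicator (influence n p j l) x -
      {x | EvenSite x}.indicator (P₁ n l p) x| ≤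
        (32 * tailConst n * 4 ^ (n + 1)) * (1 / 16) ^ j * weight x := by
  by_cases hx : EvenSite x
  · simpa [Set.indicator, hx] using abs_influence_sub_P₁_le_weight n p j l hx
  · have := tailConst_nonneg n
    have := weight_nonneg x
    simp only [Set.indicator, Set.mem_ofPred_eq, hx, if_false, sub_self, abs_zero]
    positivity

lemma summable_indicator_P₁ (n : ℕ) (p l : ℝ) [Fact (0 < l)] :
    Summable ({x | EvenSite x}.indicator (P₁ n l p)) := by
  have h1 := summable_influence n p 0 l
  have h2 := Summable.of_abs (Summable.of_nonneg_of_le (fun _ => abs_nonneg _)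
    (abs_indicator_influence_sub_le n p 0 l) (summable_weight.mul_left _))
  simpa using h1.sub h2

lemma hasDerivAt_h (n : ℕ) (p : ℝ) {lam : ℝ} (hlam : 0 < lam) :
    HasDerivAt (fun l => h n l p)
      ((1 / lam) * ∑' x, {x | EvenSite x}.indicator (P₁ n lam p) x) lam := by
  classical
  -- Staying above $\lambda/2$ bounds the prefactor $1/l$ by $2/\lambda$.
  have hmem : lam ∈ Set.Ioi (lam / 2) := by simp [hlam]
  obtain ⟨D, hD0, hb⟩ : ∃ D : ℝ, 0 ≤ D ∧ ∀ (j : ℕ) (l : ℝ) [Fact (0 < l)] (x : Site),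
      ‖{x | EvenSite x}.indicator (influence n p j l) x -
        {x | EvenSite x}.indicator (P₁ n l p) x‖ ≤ D * (1 / 16) ^ j * weight x :=
    ⟨_, by have := tailConst_nonneg n; positivity, abs_indicator_influence_sub_le n p⟩
  have hW : 0 ≤ ∑' x, weight x := tsum_nonneg weight_nonneg
  refine hasDerivAt_of_tendstoUniformlyOn (s := Set.Ioi (lam / 2)) (l := Filter.atTop)
    (f := fun j l => (law l).real {ω | CrossingBy (2 * j + 1) n p (firstArrival ω) ω.2})
    (f' := fun j l => (1 / l) * ∑' x, {x | EvenSite x}.indicator (influence n p j l) x)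
    (g' := fun l => (1 / l) * ∑' x, {x | EvenSite x}.indicator (P₁ n l p) x)
    isOpen_Ioi ?_ (.of_forall fun j l hl => ?_) (fun l hl => ?_) hmem
  · have h0 : Filter.Tendsto (fun j : ℕ => 2 / lam * (D * (1 / 16) ^ j * ∑' x, weight x))
        Filter.atTop (nhds 0) := by
      simpa using (((tendsto_pow_atTop_nhds_zero_of_lt_one (r := (1 / 16 : ℝ)) (by norm_num)
        (by norm_num)).const_mul D).mul_const (∑' x, weight x)).const_mul (2 / lam)
    rw [Metric.tendstoUniformlyOn_iff]
    intro ε hε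
    filter_upwards [h0.eventually (gt_mem_nhds hε)] with j hj l hl
    have hl' : lam / 2 < l := hl
    have hl0 : 0 < l := by linarith
    have : Fact (0 < l) := ⟨hl0⟩
    refine lt_of_le_of_lt ?_ hj
    rw [dist_comm, Real.dist_eq, ← mul_sub,
      ← (summable_influence n p j l).tsum_sub (summable_indicator_P₁ n p l), abs_mul,
      abs_of_pos (one_div_pos.2 hl0)]
    refine mul_le_mul ?_ ?_ (abs_nonneg _) (div_nonneg two_pos.le hlam.le)
    · rw [div_le_div_iff₀ hl0 hlam]; linarith
    · rw [← tsum_mul_left]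
      have hs := summable_weight.mul_left (D * (1 / 16) ^ j)
      exact tsum_of_norm_bounded hs.hasSum (hb j l)
  · have hl' : lam / 2 < l := hl
    have hl0 : 0 < l := by linarith
    refine (hasDerivAt_crossingBy n p j hl0).congr_deriv ?_
    rw [tsum_eq_sum (s := square (n + (2 * j + 1)))
      (fun x hx => by simp [Set.indicator, influence_eq_zero hx]), Finset.sum_filter]
    rfl
  · have hl' : lam / 2 < l := hl
    have : Fact (0 < l) := ⟨by linarith⟩
    exact tendsto_crossingBy n p l

/-! ### Differentiation in the enhancement parameter -/

/-- There is a crossing when the diamond at `z` is black if `T z < θ z`. -/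
def thresholdCrossing (n : ℕ) (θ : Site → ℝ) : Set Sample :=
  {ω | Crosses n (colouring (BlackSite (firstArrival ω)) θ ω.2)}

/-- Whether there is a crossing is decided by the colour of the diamond at `z`. -/
def thresholdPivotal (n : ℕ) (θ : Site → ℝ) (z : Site) : Set Sample :=
  {ω | Crosses n (fun f => colouring (BlackSite (firstArrival ω)) θ ω.2 f ∨ f = .diamond z) ∧
    ¬ Crosses n (fun f => colouring (BlackSite (firstArrival ω)) θ ω.2 f ∧ f ≠ .diamond z)}

lemma measurableSet_colouring_firstArrival (θ : Site → ℝ) (f : Face) :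
    MeasurableSet {ω : Sample | colouring (BlackSite (firstArrival ω)) θ ω.2 f} :=
  (measurable_firstArrival.prodMk measurable_snd)
    (measurableSet_colouring measurableSet_blackSite θ f)

lemma measurableSet_thresholdCrossing (n : ℕ) (θ : Site → ℝ) :
    MeasurableSet (thresholdCrossing n θ) :=
  measurableSet_crosses (measurableSet_colouring_firstArrival θ)

lemma measurableSet_thresholdPivotal (n : ℕ) (θ : Site → ℝ) (z : Site) :
    MeasurableSet (thresholdPivotal n θ z) :=
  (measurableSet_crosses fun f =>
    (measurableSet_colouring_firstArrival θ f).union (MeasurableSet.const _)).inter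
    (measurableSet_crosses fun f =>
      (measurableSet_colouring_firstArrival θ f).inter (MeasurableSet.const _)).compl

lemma h_eq (n : ℕ) (l p : ℝ) : h n l p = (law l).real (thresholdCrossing n fun _ => p) := by
  simp only [h, thresholdCrossing, crossing_iff]

/-- The enhancement variable at `z` is independent of events which do not depend on it. -/
lemma law_inter_enhancement (l : ℝ) [Fact (0 < l)] (z : Site) {E : Set Sample}
    (hE : MeasurableSet E) (hz : ∀ g T s, (g, Function.update T z s) ∈ E ↔ (g, T) ∈ E)
    {I : Set unitInterval} (hI : MeasurableSet I) :
    law l (E ∩ {ω | ω.2 z ∈ I}) = law l E * volume I := by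
  have hm : MeasurableSet (E ∩ {ω : Sample | ω.2 z ∈ I}) :=
    hE.inter (((measurable_pi_apply z).comp measurable_snd) hI)
  rw [law_eq, Measure.prod_apply hm, Measure.prod_apply hE,
    ← lintegral_mul_const _ (measurable_measure_prodMk_left hE)]
  refine lintegral_congr fun g => ?_
  exact infinitePi_inter_preimage_eval (fun _ : Site => (volume : Measure unitInterval)) z
    (measurable_prodMk_left hE) (hz g) hI

lemma volume_unitInterval_Ico {a b : ℝ} (ha : a ∈ Set.Icc (0 : ℝ) 1) (hb : b ∈ Set.Icc (0 : ℝ) 1) :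
    volume {s : unitInterval | a ≤ s ∧ (s : ℝ) < b} = ENNReal.ofReal (b - a) := by
  rw [← unitInterval.volume_Ico (x := ⟨a, ha⟩) (y := ⟨b, hb⟩)]
  rfl

lemma measurableSet_unitInterval_Ico (a b : ℝ) :
    MeasurableSet {s : unitInterval | a ≤ s ∧ (s : ℝ) < b} :=
  (measurableSet_le measurable_const measurable_subtype_coe).inter
    (measurableSet_lt measurable_subtype_coe measurable_const)

/-- Raising one threshold. -/
lemma thresholdCrossing_sub (n : ℕ) (l : ℝ) [Fact (0 < l)] {θ θ' : Site → ℝ} {z : Site}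
    (hθ : ∀ y ≠ z, θ' y = θ y) (h : θ z ∈ Set.Icc (0 : ℝ) 1) (h' : θ' z ∈ Set.Icc (0 : ℝ) 1)
    (hle : θ z ≤ θ' z) :
    (law l).real (thresholdCrossing n θ') - (law l).real (thresholdCrossing n θ) =
      (θ' z - θ z) * (law l).real (thresholdPivotal n θ z) := by
  have hsub : thresholdCrossing n θ ⊆ thresholdCrossing n θ' := by
    intro ω hω
    refine Crosses.mono ?_ hω
    rintro (y | y) _ hy
    · exact hy
    · by_cases hyz : y = z
      · subst hyz; exact lt_of_lt_of_le hy hle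
      · exact lt_of_lt_of_eq hy (hθ y hyz).symm
  -- The crossing is gained exactly when $z$ is pivotal and its variable falls between the two
  -- thresholds, two independent conditions.
  have hdiff : thresholdCrossing n θ' \ thresholdCrossing n θ =
      thresholdPivotal n θ z ∩
        {ω | ω.2 z ∈ {s : unitInterval | θ z ≤ s ∧ (s : ℝ) < θ' z}} := by
    ext ω
    by_cases hz : θ z ≤ ω.2 z ∧ (ω.2 z : ℝ) < θ' z
    · have e1 : ω ∈ thresholdCrossing n θ' ↔ Crosses n (fun f =>
          colouring (BlackSite (firstArrival ω)) θ ω.2 f ∨ f = .diamond z) := by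
        refine crosses_congr ?_
        rintro (y | y) _
        · simp [colouring]
        · by_cases hyz : y = z
          · subst hyz; simp [colouring, hz.2]
          · simp [colouring, hyz, hθ y hyz]
      have e2 : ω ∈ thresholdCrossing n θ ↔ Crosses n (fun f =>
          colouring (BlackSite (firstArrival ω)) θ ω.2 f ∧ f ≠ .diamond z) := by
        refine crosses_congr ?_
        rintro (y | y) _
        · simp [colouring]
        · by_cases hyz : y = z
          · subst hyz; simp [colouring, hz.1]
          · simp [colouring, hyz]
      rw [Set.mem_sdiff, e1, e2]
      exact (and_iff_left (b := _ ∧ _) hz).symm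
    · have e : ω ∈ thresholdCrossing n θ' ↔ ω ∈ thresholdCrossing n θ := by
        refine crosses_congr ?_
        rintro (y | y) _
        · rfl
        · by_cases hyz : y = z
          · subst hyz
            refine ⟨fun hy => ?_, fun hy => lt_of_lt_of_le hy hle⟩
            by_contra hc
            exact hz ⟨not_lt.1 hc, hy⟩
          · simp [colouring, hθ y hyz]
      rw [Set.mem_sdiff, e]
      exact iff_of_false (fun hc => hc.2 hc.1) fun hc => hz hc.2
  rw [← measureReal_sdiff hsub (measurableSet_thresholdCrossing n θ), hdiff, measureReal_def,
    law_inter_enhancement l z (measurableSet_thresholdPivotal n θ z) ?_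
      (measurableSet_unitInterval_Ico _ _), volume_unitInterval_Ico h h', ENNReal.toReal_mul,
    ENNReal.toReal_ofReal (sub_nonneg.2 hle), mul_comm]
  · rfl
  · intro g T s
    refine and_congr (crosses_congr ?_) (not_congr (crosses_congr ?_))
    all_goals
      rintro (y | y) _
      · simp only [colouring, reduceCtorEq, or_false, ne_eq, not_false_eq_true, and_true]
        exact Iff.rfl
      · by_cases hyz : y = z <;> simp [colouring, hyz]

/-- Pivotality depends continuously on the thresholds. -/
lemma abs_thresholdPivotal_sub_le (n : ℕ) (l : ℝ) [Fact (0 < l)] {θ θ' : Site → ℝ} (z : Site)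
    (D : Finset Site) (hD : ∀ y ∉ D, θ y = θ' y) (h : ∀ y, θ y ∈ Set.Icc (0 : ℝ) 1)
    (h' : ∀ y, θ' y ∈ Set.Icc (0 : ℝ) 1) :
    |(law l).real (thresholdPivotal n θ z) - (law l).real (thresholdPivotal n θ' z)| ≤
      ∑ y ∈ D, |θ y - θ' y| := by
  refine (abs_measureReal_sub_le_measureReal_symmDiff
    (measurableSet_thresholdPivotal n θ z).nullMeasurableSet
    (measurableSet_thresholdPivotal n θ' z).nullMeasurableSet).trans ?_
  let I : Site → Set unitInterval := fun y =>
    {s | min (θ y) (θ' y) ≤ s ∧ (s : ℝ) < max (θ y) (θ' y)}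
  -- If no variable in $D$ lies between its two thresholds, all colours agree.
  have hsub : symmDiff (thresholdPivotal n θ z) (thresholdPivotal n θ' z) ⊆
      ⋃ y ∈ D, {ω : Sample | ω.2 y ∈ I y} := by
    intro ω hω
    by_contra hcon
    simp only [Set.mem_iUnion, not_exists] at hcon
    have hcol : ∀ f, colouring (BlackSite (firstArrival ω)) θ ω.2 f ↔
        colouring (BlackSite (firstArrival ω)) θ' ω.2 f := by
      rintro (y | y)
      · rfl
      · by_cases hy : y ∈ D
        · have hy' : ¬ (min (θ y) (θ' y) ≤ ω.2 y ∧ (ω.2 y : ℝ) < max (θ y) (θ' y)) := hcon y hy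
          simp only [min_le_iff, lt_max_iff, not_and_or, not_or, not_le, not_lt] at hy'
          simp only [colouring]
          rcases hy' with hy' | hy'
          · simp [hy'.1, hy'.2]
          · simp [hy'.1.not_gt, hy'.2.not_gt]
        · simp [colouring, hD y hy]
    have hiff : ω ∈ thresholdPivotal n θ z ↔ ω ∈ thresholdPivotal n θ' z := by
      simp only [thresholdPivotal, Set.mem_ofPred_eq, hcol]
    rcases Set.mem_symmDiff.1 hω with ⟨h1, h2⟩ | ⟨h1, h2⟩
    · exact h2 (hiff.1 h1)
    · exact h2 (hiff.2 h1)
  refine (measureReal_mono hsub (measure_ne_top _ _)).trans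
    ((measureReal_biUnion_finset_le _ _).trans (Finset.sum_le_sum fun y _ => ?_))
  have hI := law_inter_enhancement l y .univ (by simp) (measurableSet_unitInterval_Ico
    (min (θ y) (θ' y)) (max (θ y) (θ' y)))
  rw [Set.univ_inter, measure_univ, one_mul, volume_unitInterval_Ico, max_sub_min_eq_abs'] at hI
  · exact (congrArg ENNReal.toReal hI).le.trans (ENNReal.toReal_ofReal (abs_nonneg _)).le
  · exact ⟨le_min (h y).1 (h' y).1, (min_le_left _ _).trans (h y).2⟩
  · exact ⟨(h y).1.trans (le_max_left _ _), max_le (h y).2 (h' y).2⟩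

/-- First order expansion of the probability of a crossing in the thresholds. -/
lemma abs_thresholdCrossing_sub_le (n : ℕ) (l : ℝ) [Fact (0 < l)] {p q : ℝ}
    (hp : p ∈ Set.Icc (0 : ℝ) 1) (hq : q ∈ Set.Icc (0 : ℝ) 1) (D : Finset Site) :
    |(law l).real (thresholdCrossing n fun z => if z ∈ D then q else p) -
      (law l).real (thresholdCrossing n fun _ => p) -
      (q - p) * ∑ z ∈ D, (law l).real (thresholdPivotal n (fun _ => p) z)| ≤
        (D.card : ℝ) ^ 2 * |q - p| ^ 2 := by
  induction D using Finset.induction_on with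
  | empty => simp
  | insert z D hz ih =>
    set θ : Site → ℝ := fun y => if y ∈ D then q else p with hθ
    set θ' : Site → ℝ := fun y => if y ∈ insert z D then q else p with hθ'
    have hoff : ∀ y ≠ z, θ' y = θ y := fun y hy => by simp [hθ, hθ', hy]
    have h1 : θ z = p := by simp [hθ, hz]
    have h2 : θ' z = q := by simp [hθ']
    have hmem : ∀ y, θ y ∈ Set.Icc (0 : ℝ) 1 := fun y => by simp only [hθ]; split_ifs <;> assumption
    -- Pivotality of $z$ ignores the threshold at $z$ itself; this handles $q<p$, where the roles of
    -- $\theta$ and $\theta'$ are exchanged.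
    have hpiv : thresholdPivotal n θ' z = thresholdPivotal n θ z := by
      ext ω
      refine and_congr (crosses_congr ?_) (not_congr (crosses_congr ?_))
      all_goals
        rintro (y | y) _
        · rfl
        · by_cases hyz : y = z
          · simp [hyz]
          · simp [colouring, hoff y hyz]
    have hstep : (law l).real (thresholdCrossing n θ') - (law l).real (thresholdCrossing n θ) =
        (q - p) * (law l).real (thresholdPivotal n θ z) := by
      rcases le_total p q with hpq | hpq
      · have := thresholdCrossing_sub n l hoff (h1 ▸ hp) (h2 ▸ hq) (by rwa [h1, h2])
        rwa [h1, h2] at this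
      · have := thresholdCrossing_sub n l (fun y hy => (hoff y hy).symm) (h2 ▸ hq) (h1 ▸ hp)
          (by rwa [h1, h2])
        rw [h1, h2, hpiv] at this
        linarith
    have hcont := abs_thresholdPivotal_sub_le n l (θ := θ) (θ' := fun _ => p) z D
      (fun y hy => by simp [hθ, hy]) hmem fun _ => hp
    have hsum : ∑ y ∈ D, |θ y - p| = D.card * |q - p| := by
      rw [← nsmul_eq_mul, ← Finset.sum_const]
      exact Finset.sum_congr rfl fun y hy => by simp [hθ, hy]
    rw [hsum] at hcont
    rw [Finset.sum_insert hz, Finset.card_insert_of_notMem hz]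
    have hsplit : (law l).real (thresholdCrossing n θ') -
        (law l).real (thresholdCrossing n fun _ => p) -
        (q - p) * ((law l).real (thresholdPivotal n (fun _ => p) z) +
          ∑ z ∈ D, (law l).real (thresholdPivotal n (fun _ => p) z)) =
        ((law l).real (thresholdCrossing n θ) - (law l).real (thresholdCrossing n fun _ => p) -
          (q - p) * ∑ z ∈ D, (law l).real (thresholdPivotal n (fun _ => p) z)) +
        (q - p) * ((law l).real (thresholdPivotal n θ z) -
          (law l).real (thresholdPivotal n (fun _ => p) z)) := by
      linear_combination hstep
    rw [hsplit]
    refine (abs_add_le _ _).trans ?_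
    rw [abs_mul]
    push_cast
    calc _ ≤ (D.card : ℝ) ^ 2 * |q - p| ^ 2 + |q - p| * (D.card * |q - p|) := by gcongr
      _ = ((D.card : ℝ) ^ 2 + D.card) * |q - p| ^ 2 := by ring
      _ ≤ _ := by
        gcongr
        nlinarith [(Nat.cast_nonneg D.card : (0 : ℝ) ≤ _)]

/-- Setting the variable to 0 makes the diamond black only because $0<p$, and setting it to 1 makes
it white because $p\le1$. -/
lemma P₂_eq (n : ℕ) (l : ℝ) {p : ℝ} (hp : p ∈ Set.Ioc (0 : ℝ) 1) (z : Site) :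
    P₂ n l p z = (law l).real (thresholdPivotal n (fun _ => p) z) := by
  rw [P₂]
  congr 1
  ext ω
  simp only [Set.mem_ofPred_eq, Pivotal₂, crossing_iff]
  refine and_congr (crosses_congr ?_) (not_congr (crosses_congr ?_))
  all_goals
    rintro (y | y) _
    · simp [colouring]
    · by_cases hyz : y = z
      · subst hyz; simp [colouring, hp.1, hp.2]
      · simp [colouring, hyz]

lemma thresholdPivotal_eq_empty {n : ℕ} {θ : Site → ℝ} {z : Site} (hz : z ∉ square n) :
    thresholdPivotal n θ z = ∅ := by
  refine Set.eq_empty_of_forall_notMem fun ω hω => hω.2 ((crosses_congr fun f hf => ?_).1 hω.1)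
  have hf' : f ≠ .diamond z := by
    rintro rfl
    exact hz (mem_square_of_inBox_diamond hf)
  simp [hf']

lemma thresholdCrossing_congr {n : ℕ} {θ θ' : Site → ℝ} (hθ : ∀ z ∈ square n, θ z = θ' z) :
    thresholdCrossing n θ = thresholdCrossing n θ' := by
  ext ω
  refine crosses_congr ?_
  rintro (y | y) hy
  · rfl
  · simp [colouring, hθ y (mem_square_of_inBox_diamond hy)]

lemma P₂_eq_zero {n : ℕ} (l : ℝ) {p : ℝ} (hp : p ∈ Set.Ioc (0 : ℝ) 1) {z : Site}
    (hz : z ∉ square n) : P₂ n l p z = 0 := by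
  rw [P₂_eq n l hp, thresholdPivotal_eq_empty hz, measureReal_empty]

lemma hasDerivWithinAt_h (n : ℕ) {lam : ℝ} (hlam : 0 < lam) {p : ℝ} (hp : p ∈ Set.Ioc (0 : ℝ) 1) :
    HasDerivWithinAt (fun q => h n lam q) (∑' x, P₂ n lam p x) (Set.Icc 0 1) p := by
  have : Fact (0 < lam) := ⟨hlam⟩
  rw [tsum_eq_sum fun x hx => P₂_eq_zero lam hp hx, hasDerivWithinAt_iff_isLittleO]
  refine Asymptotics.IsBigO.trans_isLittleO (g := fun q => ‖q - p‖ ^ 2) ?_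
    ((Asymptotics.isLittleO_pow_sub_sub p one_lt_two).mono nhdsWithin_le_nhds)
  refine Asymptotics.IsBigO.of_bound (((square n).card : ℝ) ^ 2) ?_
  filter_upwards [self_mem_nhdsWithin] with q hq
  have hb := abs_thresholdCrossing_sub_le n lam ⟨hp.1.le, hp.2⟩ hq (square n)
  rw [thresholdCrossing_congr (θ' := fun _ => q) fun z hz => if_pos hz, ← h_eq, ← h_eq] at hb
  simpa [P₂_eq n lam hp] using hb

end RSA

theorem proposition4p2 (n : ℕ) (lam : ℝ) (hlam : 0 < lam) :
    (∀ p ∈ Set.Icc (0 : ℝ) 1,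
      Summable (fun x : {x : RSA.Site // RSA.EvenSite x} => RSA.P₁ n lam p x) ∧
      HasDerivAt (fun l : ℝ => RSA.h n l p)
        ((1 / lam) * ∑' x : {x : RSA.Site // RSA.EvenSite x}, RSA.P₁ n lam p x) lam) ∧
    (∀ p ∈ Set.Ioc (0 : ℝ) 1,
      Summable (fun x : RSA.Site => RSA.P₂ n lam p x) ∧
      HasDerivWithinAt (fun q : ℝ => RSA.h n lam q)
        (∑' x : RSA.Site, RSA.P₂ n lam p x) (Set.Icc 0 1) p) := by
  have : Fact (0 < lam) := ⟨hlam⟩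
  refine ⟨fun p _ => ⟨?_, ?_⟩, fun p hp => ⟨?_, RSA.hasDerivWithinAt_h n hlam hp⟩⟩
  · exact summable_subtype_iff_indicator.2 (RSA.summable_indicator_P₁ n p lam)
  · exact (RSA.hasDerivAt_h n p hlam).congr_deriv
      (congrArg _ (tsum_subtype {x | RSA.EvenSite x} (RSA.P₁ n lam p)).symm)
  · exact summable_of_ne_finset_zero fun x hx => RSA.P₂_eq_zero lam hp hx
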